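/- A (planar) map is a connected finite planar graph, with loops and multiple edges allowed, embedded in the oriented sphere and considered up to deformation; a $d$-angulation is a map all of whose faces have degree $d$, and it is face-rooted if one face, the root-face, is marked. Vertices and edges are outer if they are incident to the root-face and inner otherwise. The girth is the minimal length of a cycle ($\infty$ for a tree). A weighted biorientation declares each half-edge ingoing (directed toward its vertex) or outgoing (directed toward the middle of its edge) and gives it a real weight; it is an $\mathbb{N}$-biorientation if all weights are in $\mathbb{N}=\{0,1,2,\dots\}$, ingoing half-edges having positive weight and outgoing half-edges weight $0$. An edge is $i$-way if it has exactly $i$ ingoing half-edges. The weight of an edge is the sum of the weights of its two half-edges, the weight of a vertex is the sum of the weights of its ingoing half-edges, and the indegree of a vertex is the number of its ingoing half-edges. A directed path traverses 2-way edges in either direction and 1-way edges in their direction; a circuit is a closed directed path which uses no edge or vertex twice. In the face-rooted setting a circuit is clockwise if it has the root-face on its left, and counterclockwise otherwise. A biorientation is minimal if it has no counterclockwise circuit. It is clockwise-minimal if moreover each outer edge is either 2-way or 1-way with a non-root face on its right. It is accessible if from some outer vertex every vertex can be reached by a directed path. It is admissible if the contour of the root-face is a simple cycle, each outer vertex has indegree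 $1$, and each outer edge is 1-way with weights $0$ and $1$ on its outgoing and its ingoing half-edge respectively. Let $\widetilde{\mathcal B}$ be the set of weighted biorientations that are clockwise-minimal, accessible and admissible. Let $d\ge 3$ and let $D$ be a face-rooted $d$-angulation. A $d/(d-2)$-orientation of $D$ is an $\mathbb{N}$-biorientation of $D$ in which each inner edge has weight $d-2$, each inner vertex has weight $d$, and each outer edge and each outer vertex has weight $1$. **Theorem.** $D$ admits a $d/(d-2)$-orientation if and only if $D$ has girth $d$. In this case, $D$ has exactly one minimal $d/(d-2)$-orientation, and this orientation is in $\widetilde{\mathcal B}$. -/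

import Mathlib

/-- A finite map on an oriented surface, given by its half-edges: `D` is the set of half-edges,
`next h` is the half-edge following `h` in clockwise order around the vertex incident to `h`, and
`opp h` is the other half of the edge containing `h`.  Loops and multiple edges are allowed.

The half-edge `h` also stands for its edge *traversed* from the vertex incident to `h` to the vertex
incident to `opp h`. -/
structure CombMap (D : Type*) where
  next : Equiv.Perm D
  opp : Equiv.Perm D
  opp_opp : ∀ h, opp (opp h) = h
  opp_ne : ∀ h, opp h ≠ h

namespace CombMap

variable {D : Type*} (M : CombMap D)

/-- The successor of the traversed edge `h` on the contour of the face on its left: having arrived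
at the far end of `h`, leave along the clockwise successor of `opp h`. -/
def faceNext : Equiv.Perm D := M.opp.trans M.next

/-- Vertices: cycles of `next`. -/
def Vertex : Type _ := Quotient (Equiv.Perm.SameCycle.setoid M.next)

/-- Edges: cycles of `opp`, i.e. pairs `{h, opp h}`. -/
def Edge : Type _ := Quotient (Equiv.Perm.SameCycle.setoid M.opp)

/-- Faces: cycles of `faceNext`. -/
def Face : Type _ := Quotient (Equiv.Perm.SameCycle.setoid M.faceNext)

/-- The vertex incident to the half-edge `h`. -/
def vertex (h : D) : M.Vertex := Quotient.mk _ h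

/-- The edge containing the half-edge `h`. -/
def edge (h : D) : M.Edge := Quotient.mk _ h

/-- The face on the left of the half-edge `h`, directed from its vertex to the middle of its edge.
The corner preceding `h` in clockwise order around its vertex lies in this face, so that corners
are in bijection with half-edges. -/
def leftFace (h : D) : M.Face := Quotient.mk _ h

/-- The face on the right of the half-edge `h`, directed from its vertex to the middle of its
edge. -/
def rightFace (h : D) : M.Face := M.leftFace (M.opp h)

/-- The map is a planar map with at least one edge: the underlying graph is connected and the
surface is the sphere, by the Euler relation. -/
structure IsPlanarMap : Prop where
  nonempty : Nonempty D
  connected : ∀ h h' : D, Relation.EqvGen (fun a b => b = M.next a ∨ b = M.opp a) h h'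
  euler : (Nat.card M.Vertex : ℤ) - Nat.card M.Edge + Nat.card M.Face = 2

/-- The degree of a face: the number of its corners. -/
noncomputable def faceDegree (f : M.Face) : ℕ := Nat.card {h : D // M.leftFace h = f}

/-- A `d`-angulation: a planar map all of whose faces have degree `d`. -/
structure IsAngulation (d : ℕ) : Prop where
  planar : M.IsPlanarMap
  degree : ∀ f : M.Face, M.faceDegree f = d

/-- A (simple) cycle of length `n ≥ 1`, with a direction of traversal: a cyclic sequence of
traversed edges, each starting where the previous one ends, using no vertex and no edge twice. -/
structure IsCycle {n : ℕ} (c : ZMod n → D) : Prop where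
  pos : 0 < n
  closed : ∀ i, M.vertex (c (i + 1)) = M.vertex (M.opp (c i))
  vertex_inj : Function.Injective fun i => M.vertex (c i)
  edge_inj : Function.Injective fun i => M.edge (c i)

/-- The girth: the minimal length of a cycle (`⊤` if there is no cycle). -/
noncomputable def girth : ℕ∞ := ⨅ (n : ℕ) (_ : ∃ c : ZMod n → D, M.IsCycle c), (n : ℕ∞)

/-- The face `f` is on the left of the cycle `c`: it lies in the same region of the complement of
`c` as a face on the left of an edge of `c`, that is, it can be reached from such a face by
repeatedly crossing edges which are not on `c`. -/
def IsLeftOf {n : ℕ} (c : ZMod n → D) (f : M.Face) : Prop :=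
  ∃ i, Relation.ReflTransGen
    (fun f₁ f₂ => ∃ h, (∀ j, M.edge (c j) ≠ M.edge h) ∧ M.leftFace h = f₁ ∧ M.rightFace h = f₂)
    (M.leftFace (c i)) f

/-! In a map with root-face `f₀`, vertices and edges are *outer* if they are incident to the
root-face, and *inner* otherwise. -/

/-- The vertex `v` has a corner in the root-face `f₀`. -/
def IsOuterVertex (f₀ : M.Face) (v : M.Vertex) : Prop := ∃ h, M.vertex h = v ∧ M.leftFace h = f₀

/-- The edge containing `h` has the root-face `f₀` on one of its sides. -/
def IsOuterEdge (f₀ : M.Face) (h : D) : Prop := M.leftFace h = f₀ ∨ M.rightFace h = f₀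

/-- The contour of the root-face is a simple cycle. -/
def HasSimpleContour (f₀ : M.Face) : Prop :=
  ∃ (n : ℕ) (c : ZMod n → D), M.IsCycle c ∧
    ∀ i, M.leftFace (c i) = f₀ ∧ c (i + 1) = M.faceNext (c i)

end CombMap

/-- A weighted biorientation of `M`: each half-edge is either ingoing (oriented toward its vertex)
or outgoing (oriented toward the middle of its edge), and carries a real weight. -/
@[ext]
structure WeightedBiorientation {D : Type*} (M : CombMap D) where
  ingoing : D → Prop
  weight : D → ℝ

namespace WeightedBiorientation

variable {D : Type*} {M : CombMap D} (O : WeightedBiorientation M)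

/-- The edge containing `h` is 2-way: both half-edges are ingoing. -/
def TwoWay (h : D) : Prop := O.ingoing h ∧ O.ingoing (M.opp h)

/-- The edge containing `h` is 1-way, oriented from the vertex of `h` to the vertex of `opp h`. -/
def OneWayAlong (h : D) : Prop := ¬ O.ingoing h ∧ O.ingoing (M.opp h)

/-- The edge containing `h` can be traversed, by a directed path, from the vertex of `h` to the
vertex of `opp h`. -/
def Traversable (h : D) : Prop := O.TwoWay h ∨ O.OneWayAlong h

/-- Every vertex is reachable from `u` by a directed path. -/
def AccessibleFrom (u : M.Vertex) : Prop :=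
  ∀ v, Relation.ReflTransGen
    (fun v₁ v₂ => ∃ h, O.Traversable h ∧ M.vertex h = v₁ ∧ M.vertex (M.opp h) = v₂) u v

/-- A circuit: a simple directed cycle. -/
def IsCircuit {n : ℕ} (c : ZMod n → D) : Prop := M.IsCycle c ∧ ∀ i, O.Traversable (c i)

/-- Minimal with respect to the root-face `f₀`: there is no counterclockwise circuit, i.e. every
circuit is clockwise, which means that it has the root-face on its left. -/
def IsMinimal (f₀ : M.Face) : Prop :=
  ∀ (n : ℕ) (c : ZMod n → D), O.IsCircuit c → M.IsLeftOf c f₀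

/-- Clockwise-minimal: minimal, and each outer edge is either 2-way, or 1-way with a face
different from the root-face on its right. -/
structure IsClockwiseMinimal (f₀ : M.Face) : Prop where
  minimal : O.IsMinimal f₀
  outer : ∀ h, M.IsOuterEdge f₀ h → O.TwoWay h ∨ (O.OneWayAlong h ∧ M.rightFace h ≠ f₀) ∨
    (O.OneWayAlong (M.opp h) ∧ M.rightFace (M.opp h) ≠ f₀)

/-- Accessible (with respect to the root-face `f₀`): accessible from one of the outer vertices. -/
def IsAccessible (f₀ : M.Face) : Prop := ∃ u, M.IsOuterVertex f₀ u ∧ O.AccessibleFrom u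

/-- The indegree of a vertex: the number of ingoing half-edges incident to it. -/
noncomputable def indegree (v : M.Vertex) : ℕ := Nat.card {h : D // M.vertex h = v ∧ O.ingoing h}

/-- Admissible: the root-face contour is a simple cycle, each outer vertex has indegree `1`, and
each outer edge is 1-way, with weight `0` on the outgoing and `1` on the ingoing half-edge. -/
structure IsAdmissible (f₀ : M.Face) : Prop where
  simple : M.HasSimpleContour f₀
  indegree : ∀ v, M.IsOuterVertex f₀ v → O.indegree v = 1
  outer : ∀ h, M.IsOuterEdge f₀ h →
    (O.OneWayAlong h ∧ O.weight h = 0 ∧ O.weight (M.opp h) = 1) ∨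
    (O.OneWayAlong (M.opp h) ∧ O.weight (M.opp h) = 0 ∧ O.weight h = 1)

/-- The class `𝓑̃`: clockwise-minimal, accessible, admissible weighted biorientations. -/
structure MemBTilde (f₀ : M.Face) : Prop where
  clockwiseMinimal : O.IsClockwiseMinimal f₀
  accessible : O.IsAccessible f₀
  admissible : O.IsAdmissible f₀

/-- An `ℕ`-biorientation: consistent (positive weights on ingoing half-edges, nonpositive weights
on outgoing half-edges), with weights in `ℕ`. -/
structure IsNat : Prop where
  ingoing_pos : ∀ h, O.ingoing h → 0 < O.weight h
  outgoing_nonpos : ∀ h, ¬ O.ingoing h → O.weight h ≤ 0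
  nat : ∀ h, ∃ k : ℕ, O.weight h = k

/-- The weight of the edge containing `h`: the sum of the weights of its two half-edges. -/
def edgeWeight (h : D) : ℝ := O.weight h + O.weight (M.opp h)

open scoped Classical in
/-- The weight of a vertex: the sum of the weights of the ingoing half-edges incident to it. -/
noncomputable def vertexWeight [Fintype D] (v : M.Vertex) : ℝ :=
  ∑ h : D with M.vertex h = v ∧ O.ingoing h, O.weight h

/-- A `d/(d-2)`-orientation of the map `M` with root-face `f₀`. -/
structure IsDOrientation [Fintype D] (d : ℕ) (f₀ : M.Face) : Prop where
  nat : O.IsNat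
  innerEdge : ∀ h, ¬ M.IsOuterEdge f₀ h → O.edgeWeight h = (d : ℝ) - 2
  innerVertex : ∀ v, ¬ M.IsOuterVertex f₀ v → O.vertexWeight v = d
  outerEdge : ∀ h, M.IsOuterEdge f₀ h → O.edgeWeight h = 1
  outerVertex : ∀ v, M.IsOuterVertex f₀ v → O.vertexWeight v = 1

end WeightedBiorientation

/-!
The topology of the sphere enters only through linear algebra.  In a planar map, cuts of the graph
are orthogonal to cuts of the dual graph, and by the Euler relation the two spaces together fill the
space of antisymmetric functions on half-edges.  Hence every circulation is the coboundary of a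
function on faces (`SphericalPair.exists_potential`).  Two consequences are used throughout.  The
potential of the unit flow along a cycle separates its two sides (`CombMap.IsCycle.exists_index`).
And subgraphs satisfy an Euler inequality (`SphericalPair.card_add_four_le`), which may be
applied to the map or to its dual because the hypotheses are self-dual.  Cycles are produced by one
device: the boundary of a set of faces, directed with the set on its left, can always be continued
at its end, so it contains a simple cycle (`CombMap.exists_isCycle_of_boundary`).

If there is a `d/(d-2)`-orientation, the dual Euler inequality in the region cut off by a cycle of
length `n` and not containing the root-face, compared with the weights there, gives `d ≤ n`
(`CombMap.IsDWeight.le_length`).  The map is not a tree, because a tree has fewer edges than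
vertices whereas the total weight would count both; so the boundary of the root-face contains a
cycle, of length at most `d`.

Conversely let the girth be `d`.  Each face of an induced subgraph containing a cycle has at least
`d` boundary half-edges, which bounds the number of edges of the subgraph
(`CombMap.IsPlanarMap.sparsity`).  By Hall's theorem this sparsity yields an orientation
(`CombMap.IsAngulation.exists_isDWeight`), and it also shows that every vertex is accessible from
the outer cycle.

Two orientations differ by a circulation, that is, by the coboundary of a function on faces
vanishing at the root-face.  Reversing a counterclockwise circuit increases the sum of this
potential, so an orientation of maximal potential is minimal
(`CombMap.IsDWeight.exists_isMinimal`).  If the potential of the difference of two orientations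
were positive somewhere, the boundary of its positive region, seen from the root-face, would contain
a counterclockwise circuit of one of them, hence the uniqueness
(`CombMap.IsDWeight.potential_nonpos`).  Finally, outer vertices receive all their weight from outer
edges, so the contour of the root-face is a directed cycle, and minimality determines its direction.
-/

open scoped Classical

/-! ### Circulations and cuts on the sphere -/

/-- Two maps `a : D → α` and `b : D → β` on a finite set of half-edges with involution `opp` form
a *spherical pair* if the graphs they define (a half-edge `h` joins `a h` to `a (opp h)`, resp.
`b h` to `b (opp h)`) are connected, the cuts of the first graph are orthogonal to the cuts of the
second, and the Euler relation holds.  This is what the vertex map and the left-face map of a planar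
map satisfy; the notion is symmetric in `a` and `b`, which encodes planar duality.  Connectedness
is phrased through real functions that do not vary along half-edges. -/
structure SphericalPair {D α β : Type*} [Fintype D] [Fintype α] [Fintype β]
    (opp : D → D) (a : D → α) (b : D → β) : Prop where
  nonempty : Nonempty D
  opp_opp : ∀ h, opp (opp h) = h
  opp_ne : ∀ h, opp h ≠ h
  const_left : ∀ p : α → ℝ, (∀ h, p (a (opp h)) = p (a h)) → ∀ x y, p x = p y
  const_right : ∀ φ : β → ℝ, (∀ h, φ (b (opp h)) = φ (b h)) → ∀ x y, φ x = φ y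
  orthogonal : ∀ (p : α → ℝ) (φ : β → ℝ),
    ∑ h, p (a h) * φ (b (opp h)) = ∑ h, p (a h) * φ (b h)
  euler : 2 * (Fintype.card α + Fintype.card β) = Fintype.card D + 4

section HalfEdges

variable {D : Type*} [Fintype D] {opp : D → D}

theorem sum_comp_involution (h2 : ∀ h, opp (opp h) = h) (f : D → ℝ) :
    ∑ h, f (opp h) = ∑ h, f h :=
  Fintype.sum_equiv ⟨opp, opp, h2, h2⟩ _ _ fun _ => rfl

theorem exists_orientation (h2 : ∀ h, opp (opp h) = h) (hne : ∀ h, opp h ≠ h) :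
    ∃ P : Finset D, ∀ h, opp h ∈ P ↔ h ∉ P := by
  let e := Fintype.equivFin D
  refine ⟨Finset.univ.filter fun h => e h < e (opp h), fun h => ?_⟩
  have : e (opp h) ≠ e h := fun h' => hne h (e.injective h')
  simp only [Finset.mem_filter, Finset.mem_univ, true_and, h2, not_lt]
  exact ⟨le_of_lt, fun h' => lt_of_le_of_ne h' this⟩

theorem sum_eq_sum_orientation {R : Type*} [AddCommMonoid R] (h2 : ∀ h, opp (opp h) = h)
    {P : Finset D} (hP : ∀ h, opp h ∈ P ↔ h ∉ P) (f : D → R) :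
    ∑ h, f h = ∑ h ∈ P, (f h + f (opp h)) := by
  rw [Finset.sum_add_distrib, ← Finset.sum_add_sum_compl P f]
  congr 1
  refine Finset.sum_nbij' opp opp ?_ ?_ ?_ ?_ ?_ <;> simp [h2, hP]

theorem card_filter_eq_two_mul (h2 : ∀ h, opp (opp h) = h)
    {P : Finset D} (hP : ∀ h, opp h ∈ P ↔ h ∉ P) {H : D → Prop} (hH : ∀ h, H h → H (opp h)) :
    (Finset.univ.filter H).card = 2 * (P.filter H).card := by
  have hH' : ∀ h, H (opp h) ↔ H h := fun h => ⟨fun h' => h2 h ▸ hH _ h', hH h⟩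
  rw [Finset.card_filter, sum_eq_sum_orientation h2 hP, Finset.card_filter, Finset.mul_sum]
  refine Finset.sum_congr rfl fun h _ => ?_
  simp only [hH']; split_ifs <;> rfl

end HalfEdges

namespace SphericalPair

variable {D α β : Type*} [Fintype D] [Fintype α] [Fintype β]
  {opp : D → D} {a : D → α} {b : D → β}

theorem symm (hs : SphericalPair opp a b) : SphericalPair opp b a where
  nonempty := hs.nonempty
  opp_opp := hs.opp_opp
  opp_ne := hs.opp_ne
  const_left := hs.const_right
  const_right := hs.const_left
  orthogonal φ p := by
    have h1 := hs.orthogonal p φ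
    rw [← sum_comp_involution hs.opp_opp] at h1
    simpa only [hs.opp_opp, mul_comm] using h1
  euler := by rw [add_comm (Fintype.card β), hs.euler]

theorem sum_cut_mul_cut (hs : SphericalPair opp a b) (p : α → ℝ) (φ : β → ℝ) :
    ∑ h, (p (a h) - p (a (opp h))) * (φ (b h) - φ (b (opp h))) = 0 := by
  have h1 := hs.orthogonal p φ
  have h2 := sum_comp_involution hs.opp_opp fun h => p (a h) * φ (b (opp h))
  have h3 := sum_comp_involution hs.opp_opp fun h => p (a h) * φ (b h)
  simp only [hs.opp_opp] at h2
  simp only [sub_mul, mul_sub, Finset.sum_sub_distrib]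
  linarith

/-- A cut that is the sum of a circulation and of a cut of the dual vanishes, being orthogonal
to itself. -/
theorem cut_eq_zero (hs : SphericalPair opp a b) (p : α → ℝ) (φ : β → ℝ) (z : D → ℝ)
    (hz : ∀ h, z (opp h) = -z h) (hdiv : ∀ q : α → ℝ, ∑ h, q (a h) * z h = 0)
    (heq : ∀ h, z h = p (a h) - p (a (opp h)) + (φ (b h) - φ (b (opp h)))) (h : D) :
    p (a (opp h)) = p (a h) := by
  have h1 := hs.sum_cut_mul_cut p φ
  have h2 := hdiv p
  have h3 := sum_comp_involution hs.opp_opp fun h => p (a h) * z h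
  simp only [hz] at h3
  have h4 : ∑ h, (p (a h) - p (a (opp h))) ^ 2 = 0 := by
    calc ∑ h, (p (a h) - p (a (opp h))) ^ 2
        = ∑ h, (p (a h) * z h + p (a (opp h)) * -z h
            - (p (a h) - p (a (opp h))) * (φ (b h) - φ (b (opp h)))) :=
          Finset.sum_congr rfl fun h _ => by rw [heq h]; ring
      _ = 0 := by rw [Finset.sum_sub_distrib, Finset.sum_add_distrib, h1, h3, h2]; ring
  have h5 := (Finset.sum_eq_zero_iff_of_nonneg fun h _ => sq_nonneg _).1 h4 h (Finset.mem_univ h)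
  exact (sub_eq_zero.1 (pow_eq_zero_iff two_ne_zero |>.1 h5)).symm

/-- On the sphere every circulation is a cut of the dual graph: cuts and dual cuts are orthogonal,
and by the Euler relation their dimensions add up to the number of edges. -/
theorem exists_potential (hs : SphericalPair opp a b) (z : D → ℝ)
    (hz : ∀ h, z (opp h) = -z h) (hdiv : ∀ p : α → ℝ, ∑ h, p (a h) * z h = 0) :
    ∃ φ : β → ℝ, ∀ h, z h = φ (b h) - φ (b (opp h)) := by
  obtain ⟨h₀⟩ := hs.nonempty
  obtain ⟨P, hP⟩ := exists_orientation hs.opp_opp hs.opp_ne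
  -- the sum of a cut and of a dual cut, the potentials being normalised by their values at `h₀`
  let Ψ : ((α → ℝ) × (β → ℝ)) →ₗ[ℝ] ((P → ℝ) × (ℝ × ℝ)) :=
    { toFun := fun x => (fun h => x.1 (a h) - x.1 (a (opp h)) + (x.2 (b h) - x.2 (b (opp h))),
        (x.1 (a h₀), x.2 (b h₀)))
      map_add' := fun x y => by
        ext <;> simp; ring
      map_smul' := fun c x => by
        ext <;> simp; ring }
  have hcard : Fintype.card D = 2 * P.card := by
    simpa using card_filter_eq_two_mul hs.opp_opp hP (H := fun _ => True) (by simp)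
  have hdim : Module.finrank ℝ ((α → ℝ) × (β → ℝ)) = Module.finrank ℝ ((P → ℝ) × (ℝ × ℝ)) := by
    have := hs.euler
    simp only [Module.finrank_prod, Module.finrank_fintype_fun_eq_card, Module.finrank_self,
      Fintype.card_coe]
    omega
  have ext_anti : ∀ f g : D → ℝ, (∀ h, f (opp h) = -f h) → (∀ h, g (opp h) = -g h) →
      (∀ h ∈ P, f h = g h) → ∀ h, f h = g h := by
    intro f g hf hg hfg h
    by_cases hh : h ∈ P
    · exact hfg h hh
    · have := hfg _ ((hP h).2 hh)
      rw [hf, hg] at this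
      exact neg_injective this
  have hinj : Function.Injective Ψ := by
    rw [← LinearMap.ker_eq_bot, LinearMap.ker_eq_bot']
    rintro ⟨p, φ⟩ hx
    have hx1 := congrArg Prod.fst hx
    have hp0 : p (a h₀) = 0 := congrArg (fun x => x.2.1) hx
    have hφ0 : φ (b h₀) = 0 := congrArg (fun x => x.2.2) hx
    have key : ∀ h, (0 : ℝ) = p (a h) - p (a (opp h)) + (φ (b h) - φ (b (opp h))) := by
      refine ext_anti (fun _ => 0) _ (by simp) (fun h => by simp only [hs.opp_opp]; ring) ?_
      intro h hh
      exact (congrFun hx1 ⟨h, hh⟩).symm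
    have hp := hs.cut_eq_zero p φ (fun _ => 0) (by simp) (by simp) key
    have hφ : ∀ h, φ (b (opp h)) = φ (b h) := fun h => by
      have := key h
      rw [hp h] at this
      linarith
    ext x
    · exact (hs.const_left p hp x (a h₀)).trans hp0
    · exact (hs.const_right φ hφ x (b h₀)).trans hφ0
  obtain ⟨⟨p, φ⟩, hx⟩ := (LinearMap.injective_iff_surjective_of_finrank_eq_finrank hdim).1 hinj
    (fun h => z h, (0, 0))
  have key : ∀ h, z h = p (a h) - p (a (opp h)) + (φ (b h) - φ (b (opp h))) := by
    refine ext_anti _ _ hz (fun h => by simp only [hs.opp_opp]; ring) ?_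
    intro h hh
    exact (congrFun (congrArg Prod.fst hx) ⟨h, hh⟩).symm
  refine ⟨φ, fun h => ?_⟩
  rw [key h, hs.cut_eq_zero p φ z hz hdiv key h]
  ring

/-- The Euler relation, as an inequality, for a subgraph with vertex set `S ≠ ∅` and set of
half-edges `H`.  The faces of the subgraph are the classes of `β` under crossing half-edges outside
`H`; the hypothesis on `T` says that `T` meets each of them. -/
theorem card_add_four_le (hs : SphericalPair opp a b) {H : D → Prop} {S : Finset α} {T : Finset β}
    (hS : S.Nonempty) (hH : ∀ h, H h → H (opp h)) (hHS : ∀ h, H h → a h ∈ S)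
    (hT : ∀ φ : β → ℝ, (∀ h, ¬ H h → φ (b (opp h)) = φ (b h)) → (∀ t ∈ T, φ t = 0) →
      ∀ x, φ x = 0) :
    (Finset.univ.filter H).card + 4 ≤ 2 * S.card + 2 * T.card := by
  obtain ⟨h₀⟩ := hs.nonempty
  obtain ⟨P, hP⟩ := exists_orientation hs.opp_opp hs.opp_ne
  rw [card_filter_eq_two_mul hs.opp_opp hP hH]
  set Q := P.filter H with hQ
  have hQmem : ∀ {h}, h ∈ Q ↔ h ∈ P ∧ H h := by simp [hQ]
  -- antisymmetric extension of a function on `Q`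
  let E : (Q → ℝ) →ₗ[ℝ] (D → ℝ) := LinearMap.pi fun h =>
    (if hh : h ∈ Q then LinearMap.proj ⟨h, hh⟩ else 0) -
      (if hh : opp h ∈ Q then LinearMap.proj ⟨opp h, hh⟩ else 0)
  have E_anti : ∀ y h, E y (opp h) = -E y h := by
    intro y h
    simp only [E, LinearMap.pi_apply, LinearMap.sub_apply, hs.opp_opp]
    ring
  have E_off : ∀ y h, ¬ H h → E y h = 0 := by
    intro y h hh
    have h1 : h ∉ Q := fun h' => hh (hQmem.1 h').2
    have h2 : opp h ∉ Q := fun h' => hh (hs.opp_opp h ▸ hH _ (hQmem.1 h').2)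
    simp [E, h1, h2]
  have E_on : ∀ y (h : Q), E y h = y h := by
    intro y h
    have h2 : opp h ∉ Q := fun h' => ((hP h).1 (hQmem.1 h').1) (hQmem.1 h.2).1
    simp [E, h2]
  -- the divergence, with the constants added so that it becomes onto
  let δ : ((Q → ℝ) × (ℝ × ℝ)) →ₗ[ℝ] (S → ℝ) := LinearMap.pi fun s =>
    (∑ h : D, if a h = s then
      (LinearMap.proj h ∘ₗ E ∘ₗ LinearMap.fst ℝ (Q → ℝ) (ℝ × ℝ)) else 0) +
      LinearMap.fst ℝ ℝ ℝ ∘ₗ LinearMap.snd ℝ (Q → ℝ) (ℝ × ℝ)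
  have δ_apply : ∀ x s, δ x s = (∑ h : D, if a h = s then E x.1 h else 0) + x.2.1 := by
    intro x s
    simp only [δ, LinearMap.pi_apply, LinearMap.add_apply, LinearMap.sum_apply]
    congr 1
    refine Finset.sum_congr rfl fun h _ => ?_
    split_ifs <;> simp
  let W : Submodule ℝ (β → ℝ) :=
    { carrier := {φ | ∀ h, ¬ H h → φ (b (opp h)) = φ (b h)}
      add_mem' := fun {x y} hx hy h hh => by simp [hx h hh, hy h hh]
      zero_mem' := fun h _ => rfl
      smul_mem' := fun c x hx h hh => by simp [hx h hh] }
  let G : W →ₗ[ℝ] ((Q → ℝ) × (ℝ × ℝ)) :=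
    { toFun := fun φ => (fun h => φ.1 (b h) - φ.1 (b (opp h)), (0, φ.1 (b h₀)))
      map_add' := fun x y => by
        ext <;> simp; ring
      map_smul' := fun c x => by
        ext <;> simp; ring }
  have hW : Module.finrank ℝ W ≤ T.card := by
    let ρ : W →ₗ[ℝ] (T → ℝ) := (LinearMap.funLeft ℝ ℝ (Subtype.val : T → β)) ∘ₗ W.subtype
    have hρ : Function.Injective ρ := by
      rw [← LinearMap.ker_eq_bot, LinearMap.ker_eq_bot']
      intro φ hφ
      ext x
      exact hT φ.1 φ.2 (fun t ht => congrFun hφ ⟨t, ht⟩) x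
    simpa using LinearMap.finrank_le_finrank_of_injective hρ
  have hker : LinearMap.ker δ ≤ LinearMap.range G := by
    rintro ⟨y, c, c'⟩ hx
    have hx' : ∀ s : S, (∑ h : D, if a h = s then E y h else 0) + c = 0 := fun s => by
      rw [← δ_apply (y, c, c') s, LinearMap.mem_ker.1 hx]; rfl
    have hpair : ∀ p : α → ℝ, ∑ h, p (a h) * E y h = -c * ∑ s ∈ S, p s := by
      intro p
      calc ∑ h, p (a h) * E y h
          = ∑ h, ∑ s ∈ S, p s * (if a h = s then E y h else 0) := by
            refine Finset.sum_congr rfl fun h _ => ?_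
            by_cases hh : H h
            · simp [hHS h hh]
            · simp [E_off y h hh]
        _ = ∑ s ∈ S, p s * -c := by
            rw [Finset.sum_comm]
            refine Finset.sum_congr rfl fun s hs => ?_
            rw [← Finset.mul_sum, ← eq_neg_of_add_eq_zero_left (hx' ⟨s, hs⟩)]
        _ = _ := by rw [← Finset.sum_mul, mul_comm]
    have hc : c = 0 := by
      have h1 := hpair fun _ => 1
      have h2 := sum_comp_involution hs.opp_opp (E y)
      simp only [E_anti, Finset.sum_neg_distrib] at h2
      simp only [one_mul, Finset.sum_const, nsmul_eq_mul, mul_one] at h1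
      have h3 : c * (S.card : ℝ) = 0 := by linarith
      exact (mul_eq_zero.1 h3).resolve_right (by exact_mod_cast hS.card_pos.ne')
    subst hc
    obtain ⟨φ, hφ⟩ := hs.exists_potential (E y) (E_anti y) (fun p => by simpa using hpair p)
    refine ⟨⟨fun x => φ x - φ (b h₀) + c', fun h hh => ?_⟩, ?_⟩
    · have := hφ h
      rw [E_off y h hh] at this
      dsimp only
      linarith
    · ext h
      · simp [G, ← E_on y h, hφ]
      · simp [G]
      · simp [G]
  have h1 := LinearMap.finrank_range_add_finrank_ker δ
  have h2 := Submodule.finrank_mono hker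
  have h3 := LinearMap.finrank_range_le G
  have h4 := Submodule.finrank_le (LinearMap.range δ)
  simp only [Module.finrank_prod, Module.finrank_fintype_fun_eq_card, Module.finrank_self,
    Fintype.card_coe] at h1 h4
  omega

end SphericalPair

/-! ### Half-edges, cycles and the Jordan curve theorem -/

namespace CombMap

variable {D : Type*} (M : CombMap D)

instance [Finite D] : Finite M.Vertex := Quotient.finite _

instance [Finite D] : Finite M.Face := Quotient.finite _

noncomputable instance [Finite D] : Fintype M.Vertex := Fintype.ofFinite _

noncomputable instance [Finite D] : Fintype M.Face := Fintype.ofFinite _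

theorem vertex_next (h : D) : M.vertex (M.next h) = M.vertex h :=
  Quotient.sound (Equiv.Perm.sameCycle_apply_left.2 (Equiv.Perm.SameCycle.refl _ _))

theorem leftFace_faceNext (h : D) : M.leftFace (M.faceNext h) = M.leftFace h :=
  Quotient.sound (Equiv.Perm.sameCycle_apply_left.2 (Equiv.Perm.SameCycle.refl _ _))

theorem leftFace_next (h : D) : M.leftFace (M.next h) = M.rightFace h := by
  have := M.leftFace_faceNext (M.opp h)
  rwa [faceNext, Equiv.trans_apply, M.opp_opp] at this

theorem vertex_faceNext (h : D) : M.vertex (M.faceNext h) = M.vertex (M.opp h) :=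
  M.vertex_next _

theorem rightFace_opp (h : D) : M.rightFace (M.opp h) = M.leftFace h := by
  rw [rightFace, M.opp_opp]

theorem edge_opp (h : D) : M.edge (M.opp h) = M.edge h :=
  Quotient.sound (Equiv.Perm.sameCycle_apply_left.2 (Equiv.Perm.SameCycle.refl _ _))

theorem edge_eq_iff {h g : D} : M.edge h = M.edge g ↔ g = h ∨ g = M.opp h := by
  constructor
  · intro hg
    obtain ⟨n, hn⟩ : M.opp.SameCycle h g := Quotient.exact hg
    have h2 : ∀ k : ℤ, (M.opp ^ (2 * k)) h = h := fun k => by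
      have : M.opp ^ (2 : ℤ) = 1 := by
        ext x; simp [zpow_ofNat, pow_two, M.opp_opp]
      rw [zpow_mul, this, one_zpow, Equiv.Perm.one_apply]
    rcases Int.even_or_odd' n with ⟨k, rfl | rfl⟩
    · exact Or.inl (by rw [← hn, h2])
    · refine Or.inr ?_
      rw [← hn, add_comm, zpow_add, Equiv.Perm.mul_apply, h2, zpow_one]
  · rintro (rfl | rfl)
    · rfl
    · exact (M.edge_opp h).symm

theorem vertex_surjective : Function.Surjective M.vertex := Quotient.mk_surjective

theorem leftFace_surjective : Function.Surjective M.leftFace := Quotient.mk_surjective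

/-- A property preserved by turning clockwise around a vertex holds at all its half-edges as soon
as it holds at one of them. -/
theorem of_vertex_eq [Finite D] {p : D → Prop} (hp : ∀ h, p h → p (M.next h)) {h g : D}
    (hg : M.vertex h = M.vertex g) (hh : p h) : p g := by
  obtain ⟨n, -, hn⟩ := (Quotient.exact hg : M.next.SameCycle h g).exists_pow_eq'
  have key : ∀ k : ℕ, p ((M.next ^ k) h) := fun k => by
    induction k with
    | zero => simpa using hh
    | succ k ih => rw [pow_succ', Equiv.Perm.mul_apply]; exact hp _ ih
  exact hn ▸ key n

theorem card_eq_two_mul_card_edge [Fintype D] : Fintype.card D = 2 * Nat.card M.Edge := by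
  obtain ⟨P, hP⟩ := exists_orientation M.opp_opp M.opp_ne
  have h1 : Fintype.card D = 2 * P.card := by
    simpa using card_filter_eq_two_mul M.opp_opp hP (H := fun _ => True) (by simp)
  have h2 : Function.Bijective fun h : P => M.edge h := by
    constructor
    · rintro ⟨h, hh⟩ ⟨g, hg⟩ hgh
      rcases M.edge_eq_iff.1 hgh with h' | h'
      · exact Subtype.ext h'.symm
      · exact absurd hh ((hP h).1 (h' ▸ hg))
    · intro e
      obtain ⟨h, rfl⟩ : ∃ h, M.edge h = e := Quotient.mk_surjective e
      by_cases hh : h ∈ P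
      · exact ⟨⟨h, hh⟩, rfl⟩
      · exact ⟨⟨_, (hP h).2 hh⟩, M.edge_opp h⟩
  rw [h1, ← Nat.card_eq_of_bijective _ h2, Nat.card_eq_fintype_card, Fintype.card_coe]

variable {M}

theorem sum_vertex_mul_rightFace [Fintype D] (p : M.Vertex → ℝ) (φ : M.Face → ℝ) :
    ∑ h, p (M.vertex h) * φ (M.rightFace h) = ∑ h, p (M.vertex h) * φ (M.leftFace h) :=
  Fintype.sum_equiv M.next _ _ fun h => by rw [vertex_next, leftFace_next]

theorem IsPlanarMap.sphericalPair [Fintype D] (hM : M.IsPlanarMap) :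
    SphericalPair M.opp M.vertex M.leftFace where
  nonempty := hM.nonempty
  opp_opp := M.opp_opp
  opp_ne := M.opp_ne
  const_left p hp x y := by
    obtain ⟨h, rfl⟩ := M.vertex_surjective x
    obtain ⟨g, rfl⟩ := M.vertex_surjective y
    induction hM.connected h g with
    | rel a b hab =>
      rcases hab with rfl | rfl
      · rw [vertex_next]
      · exact (hp a).symm
    | refl => rfl
    | symm _ _ _ ih => exact ih.symm
    | trans _ _ _ _ _ ih ih' => exact ih.trans ih'
  const_right φ hφ x y := by
    obtain ⟨h, rfl⟩ := M.leftFace_surjective x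
    obtain ⟨g, rfl⟩ := M.leftFace_surjective y
    induction hM.connected h g with
    | rel a b hab =>
      rcases hab with rfl | rfl
      · rw [leftFace_next, rightFace, hφ]
      · exact (hφ a).symm
    | refl => rfl
    | symm _ _ _ ih => exact ih.symm
    | trans _ _ _ _ _ ih ih' => exact ih.trans ih'
  orthogonal p φ := sum_vertex_mul_rightFace p φ
  euler := by
    have h1 := hM.euler
    have h2 := M.card_eq_two_mul_card_edge
    simp only [Nat.card_eq_fintype_card (α := M.Vertex), Nat.card_eq_fintype_card (α := M.Face)]
      at h1
    omega

/-- The dual graph of a planar map is connected: a set of faces other than `∅` and the set of all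
faces has a boundary half-edge. -/
theorem IsPlanarMap.exists_boundary [Fintype D] (hM : M.IsPlanarMap) {A : Set M.Face}
    {f g : M.Face} (hf : f ∈ A) (hg : g ∉ A) : ∃ h, M.leftFace h ∈ A ∧ M.rightFace h ∉ A := by
  by_contra! hA
  have hA' : ∀ h, M.rightFace h ∈ A ↔ M.leftFace h ∈ A := fun h =>
    ⟨fun h' => by simpa only [rightFace_opp] using hA (M.opp h) h', hA h⟩
  have := hM.sphericalPair.const_right (fun x => if x ∈ A then 1 else 0) (fun h => by
    change (if M.rightFace h ∈ A then (1 : ℝ) else 0) = _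
    simp only [hA']) f g
  simp [hf, hg] at this

/-- A nonempty set of half-edges without opposite elements, in which every half-edge can be
followed by another one, contains a simple cycle: follow successors from any half-edge and stop
at the shortest return to a vertex. -/
theorem exists_isCycle_of_succ [Finite D] {X : Set D} (hX : X.Nonempty)
    (hopp : ∀ h ∈ X, M.opp h ∉ X)
    (hsucc : ∀ h ∈ X, ∃ g ∈ X, M.vertex g = M.vertex (M.opp h)) :
    ∃ (n : ℕ) (c : ZMod n → D), M.IsCycle c ∧ ∀ i, c i ∈ X := by
  choose! s hsX hs using hsucc
  obtain ⟨x, hx⟩ := hX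
  have hxX : ∀ k, s^[k] x ∈ X := fun k => by
    induction k with
    | zero => exact hx
    | succ k ih => rw [Function.iterate_succ_apply']; exact hsX _ ih
  have hclosed : ∀ k, M.vertex (s^[k + 1] x) = M.vertex (M.opp (s^[k] x)) := fun k => by
    rw [Function.iterate_succ_apply']; exact hs _ (hxX k)
  have hex : ∃ n, 0 < n ∧ ∃ k, M.vertex (s^[k + n] x) = M.vertex (s^[k] x) := by
    obtain ⟨i, j, hij, h⟩ := Finite.exists_ne_map_eq_of_infinite fun k => M.vertex (s^[k] x)
    rcases lt_or_gt_of_ne hij with hlt | hlt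
    · exact ⟨j - i, by omega, i, by rw [Nat.add_sub_cancel' hlt.le]; exact h.symm⟩
    · exact ⟨i - j, by omega, j, by rw [Nat.add_sub_cancel' hlt.le]; exact h⟩
  set n := Nat.find hex with hn
  obtain ⟨hpos, k, hk⟩ := Nat.find_spec hex
  rw [← hn] at hpos hk
  have : NeZero n := ⟨hpos.ne'⟩
  have hmin : ∀ i j : ℕ, i < j → j < n →
      M.vertex (s^[k + j] x) ≠ M.vertex (s^[k + i] x) := fun i j hij hjn h =>
    Nat.find_min hex (m := j - i) (by omega)
      ⟨by omega, k + i, by rwa [show k + i + (j - i) = k + j by omega]⟩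
  have vinj : Function.Injective fun i : ZMod n => M.vertex (s^[k + i.val] x) := by
    intro i j hij
    rcases lt_trichotomy i.val j.val with h | h | h
    · exact absurd hij.symm (hmin _ _ h (ZMod.val_lt j))
    · exact ZMod.val_injective n h
    · exact absurd hij (hmin _ _ h (ZMod.val_lt i))
  refine ⟨n, fun i => s^[k + i.val] x, ⟨hpos, fun i => ?_, vinj, fun i j hij => ?_⟩,
    fun i => hxX _⟩
  · rw [← hclosed]
    rcases Nat.lt_or_ge (i.val + 1) n with h | h
    · have h1 : (i + 1).val = i.val + 1 := by
        rw [← ZMod.natCast_zmod_val i, ← Nat.cast_one, ← Nat.cast_add, ZMod.natCast_zmod_val,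
          ZMod.val_natCast, Nat.mod_eq_of_lt h]
      rw [h1, add_assoc]
    · have h1 : i.val + 1 = n := le_antisymm (ZMod.val_lt i) h
      have h2 : i + 1 = 0 := by
        rw [← ZMod.natCast_zmod_val i, ← Nat.cast_one, ← Nat.cast_add, h1, ZMod.natCast_self]
      rw [h2, ZMod.val_zero, add_assoc, h1, add_zero, hk]
  · rcases M.edge_eq_iff.1 hij with h | h
    · exact vinj (congrArg M.vertex h.symm)
    · exact absurd (h ▸ hxX _) (hopp _ (hxX (k + i.val)))

/-- The boundary of a set of faces, directed so as to keep the set on its left, contains a simple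
cycle. -/
theorem exists_isCycle_of_boundary [Finite D] {A : Set M.Face} {h₀ : D}
    (hl : M.leftFace h₀ ∈ A) (hr : M.rightFace h₀ ∉ A) :
    ∃ (n : ℕ) (c : ZMod n → D), M.IsCycle c ∧
      ∀ i, M.leftFace (c i) ∈ A ∧ M.rightFace (c i) ∉ A := by
  refine exists_isCycle_of_succ (X := {h | M.leftFace h ∈ A ∧ M.rightFace h ∉ A})
    ⟨h₀, hl, hr⟩ (fun h hh hh' => hh.2 hh'.1) fun h hh => ?_
  by_contra! hno
  -- turning around the end of `h`, from the successor of `h` on its left face to `opp h`, one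
  -- never leaves `A`
  have := M.of_vertex_eq (p := fun g => M.vertex g = M.vertex (M.opp h) ∧ M.leftFace g ∈ A)
    (h := M.faceNext h) (g := M.opp h) (fun g hg => ⟨(M.vertex_next g).trans hg.1, by
      rw [leftFace_next]
      by_contra hg'
      exact hno g ⟨hg.2, hg'⟩ hg.1⟩) (M.vertex_faceNext h)
    ⟨M.vertex_faceNext h, by rw [leftFace_faceNext]; exact hh.1⟩
  exact hh.2 this.2

namespace IsCycle

variable {n : ℕ} {c : ZMod n → D}

theorem neZero (hc : M.IsCycle c) : NeZero n := ⟨hc.pos.ne'⟩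

theorem injective (hc : M.IsCycle c) : Function.Injective c := fun _ _ h =>
  hc.vertex_inj (congrArg M.vertex h)

theorem opp_ne (hc : M.IsCycle c) (i j : ZMod n) : M.opp (c i) ≠ c j := fun h => by
  have : i = j := hc.edge_inj (by simp only [← h, edge_opp])
  subst this
  exact M.opp_ne _ h

theorem forall_edge_ne_iff {h : D} :
    (∀ j, M.edge (c j) ≠ M.edge h) ↔ (∀ j, c j ≠ h) ∧ ∀ j, M.opp (c j) ≠ h := by
  simp only [ne_eq, edge_eq_iff, not_or, forall_and]
  simp only [eq_comm]

theorem eq_or_eq_of_vertex_eq (hc : M.IsCycle c) {h : D} {i : ZMod n}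
    (hv : M.vertex h = M.vertex (c i)) (hh : ∃ j, M.edge (c j) = M.edge h) :
    h = c i ∨ h = M.opp (c (i - 1)) := by
  obtain ⟨j, hj⟩ := hh
  rcases M.edge_eq_iff.1 hj with rfl | rfl
  · exact Or.inl (congrArg c (hc.vertex_inj hv))
  · rw [← hc.closed] at hv
    have : j + 1 = i := hc.vertex_inj hv
    exact Or.inr (by rw [← this, add_sub_cancel_right])

theorem const_of_add_one (hc : M.IsCycle c) {R : Type*} {f : ZMod n → R}
    (hf : ∀ i, f (i + 1) = f i) (i j : ZMod n) : f i = f j := by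
  have := hc.neZero
  have h0 : ∀ k : ℕ, f (k : ZMod n) = f 0 := fun k => by
    induction k with
    | zero => simp
    | succ k ih => rw [Nat.cast_succ, hf, ih]
  rw [← ZMod.natCast_zmod_val i, ← ZMod.natCast_zmod_val j, h0, h0]

theorem eq_of_isLeftOf {φ : M.Face → ℝ}
    (hφ : ∀ h, (∀ j, M.edge (c j) ≠ M.edge h) → φ (M.leftFace h) = φ (M.rightFace h))
    {f : M.Face} (hf : M.IsLeftOf c f) : ∃ i, φ (M.leftFace (c i)) = φ f := by
  obtain ⟨i, hi⟩ := hf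
  refine ⟨i, ?_⟩
  induction hi with
  | refl => rfl
  | tail _ h2 ih =>
    obtain ⟨h, hh, rfl, rfl⟩ := h2
    rw [ih, hφ h hh]

variable [Fintype D]

theorem card_halfEdges (hc : M.IsCycle c) :
    (Finset.univ.filter fun h => ∃ j, M.edge (c j) = M.edge h).card = 2 * n := by
  have := hc.neZero
  refine (congrArg Finset.card (?_ : _ = Finset.univ.image c ∪
    Finset.univ.image fun i => M.opp (c i))).trans ?_
  · ext h
    simp only [edge_eq_iff, exists_or, Finset.mem_filter, Finset.mem_univ, true_and,
      Finset.mem_union, Finset.mem_image, @eq_comm _ h]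
  rw [Finset.card_union_of_disjoint, Finset.card_image_of_injective _ hc.injective,
    Finset.card_image_of_injective _ (f := fun i => M.opp (c i))
      (M.opp.injective.comp hc.injective), Finset.card_univ,
    ZMod.card, two_mul]
  rw [Finset.disjoint_left]
  rintro _ h1 h2
  simp only [Finset.mem_image, Finset.mem_univ, true_and] at h1 h2
  obtain ⟨i, rfl⟩ := h1
  obtain ⟨j, hj⟩ := h2
  exact hc.opp_ne _ _ hj

/-- The unit flow along a cycle has no divergence. -/
theorem sum_flow (hc : M.IsCycle c) (p : M.Vertex → ℝ) :
    ∑ h, p (M.vertex h) * ((if ∃ i, c i = h then 1 else 0) -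
      (if ∃ i, c i = M.opp h then 1 else 0)) = 0 := by
  have h2 := sum_comp_involution M.opp_opp fun h =>
    p (M.vertex (M.opp h)) * (if ∃ i, c i = h then 1 else 0)
  simp only [M.opp_opp] at h2
  simp only [mul_sub, Finset.sum_sub_distrib]
  rw [h2]
  have := hc.neZero
  have key : ∀ (X : D → Prop), (∀ h, X h ↔ ∃ i, c i = h) → ∀ q : D → ℝ,
      ∑ h, q h * (if X h then 1 else 0) = ∑ i, q (c i) := by
    intro X hX q
    simp only [mul_ite, mul_one, mul_zero]
    rw [← Finset.sum_filter, ← Finset.sum_image (f := q) fun i _ j _ h => hc.injective h]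
    refine Finset.sum_congr ?_ fun _ _ => rfl
    ext h; simp [hX]
  rw [key _ (fun _ => Iff.rfl), key _ (fun _ => Iff.rfl) fun h => p (M.vertex (M.opp h))]
  simp only [← hc.closed]
  rw [sub_eq_zero]
  exact (Equiv.sum_comp (Equiv.addRight (1 : ZMod n)) fun i => p (M.vertex (c i))).symm

/-- The Jordan curve theorem: there is a function on faces that is unchanged when crossing an edge
outside the cycle `c`, and decreases by `1` when crossing `c` from left to right. -/
theorem exists_index (hM : M.IsPlanarMap) (hc : M.IsCycle c) :
    ∃ ψ : M.Face → ℝ,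
      (∀ h, (∀ j, M.edge (c j) ≠ M.edge h) → ψ (M.leftFace h) = ψ (M.rightFace h)) ∧
      ∀ i, ψ (M.leftFace (c i)) = ψ (M.rightFace (c i)) + 1 := by
  obtain ⟨ψ, hψ⟩ := hM.sphericalPair.exists_potential
    (fun h => (if ∃ i, c i = h then 1 else 0) - (if ∃ i, c i = M.opp h then 1 else 0))
    (fun h => by simp only [M.opp_opp]; ring) hc.sum_flow
  refine ⟨ψ, fun h hh => ?_, fun i => ?_⟩
  · have h1 := hψ h
    obtain ⟨h2, h3⟩ := (forall_edge_ne_iff (c := c)).1 hh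
    have h4 : ∀ j, c j ≠ M.opp h := fun j hj => h3 j (by rw [hj, M.opp_opp])
    simp only [h2, h4, exists_false, if_false, sub_self] at h1
    exact (sub_eq_zero.1 h1.symm)
  · have h1 := hψ (c i)
    have h2 : ¬ ∃ j, c j = M.opp (c i) := fun ⟨j, hj⟩ => hc.opp_ne i j hj.symm
    rw [if_pos ⟨i, rfl⟩, if_neg h2, sub_zero] at h1
    change (1 : ℝ) = _ - ψ (M.rightFace (c i)) at h1
    linarith

/-- A function on faces that can only vary across a cycle varies by the same amount across all the
edges of the cycle. -/
theorem jump_eq (hc : M.IsCycle c) {φ : M.Face → ℝ}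
    (hφ : ∀ h, (∀ j, M.edge (c j) ≠ M.edge h) → φ (M.leftFace h) = φ (M.rightFace h))
    (i j : ZMod n) :
    φ (M.leftFace (c i)) - φ (M.rightFace (c i)) =
      φ (M.leftFace (c j)) - φ (M.rightFace (c j)) := by
  refine hc.const_of_add_one (f := fun i => φ (M.leftFace (c i)) - φ (M.rightFace (c i)))
    (fun i => ?_) i j
  have h1 := sum_vertex_mul_rightFace (M := M)
    (fun v => if v = M.vertex (c (i + 1)) then 1 else 0) φ
  rw [eq_comm, ← sub_eq_zero, ← Finset.sum_sub_distrib] at h1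
  simp only [← mul_sub] at h1
  rw [Fintype.sum_eq_add (c (i + 1)) (M.opp (c i)) (hc.opp_ne i (i + 1)).symm] at h1
  · simp only [(hc.closed i).symm, if_true, one_mul, rightFace_opp] at h1
    change _ + (φ (M.rightFace (c i)) - _) = 0 at h1
    linarith
  · rintro h ⟨h2, h3⟩
    by_cases hv : M.vertex h = M.vertex (c (i + 1))
    · rw [hφ h, sub_self, mul_zero]
      intro j hj
      rcases hc.eq_or_eq_of_vertex_eq hv ⟨j, hj⟩ with h4 | h4
      · exact h2 h4
      · exact h3 (by rw [h4, add_sub_cancel_right])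
    · rw [if_neg hv, zero_mul]

/-- If a face is on the left of a cycle, it is joined to no face on the right of the cycle. -/
theorem index_ne_of_isLeftOf (hM : M.IsPlanarMap) (hc : M.IsCycle c) {f : M.Face}
    (hf : M.IsLeftOf c f) {i : ZMod n}
    (hr : ∀ φ : M.Face → ℝ, (∀ h, (∀ j, M.edge (c j) ≠ M.edge h) →
      φ (M.leftFace h) = φ (M.rightFace h)) → φ (M.rightFace (c i)) = φ f) : False := by
  obtain ⟨ψ, hψ, hψ'⟩ := hc.exists_index hM
  obtain ⟨j, hj⟩ := eq_of_isLeftOf (φ := ψ) hψ hf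
  have h1 := hr ψ hψ
  -- from left to right, this indicator would increase across `c i` and decrease across `c j`
  let g : M.Face → ℝ := fun x => if ψ x = ψ f then 1 else 0
  have hg : ∀ h, (∀ j, M.edge (c j) ≠ M.edge h) → g (M.leftFace h) = g (M.rightFace h) :=
    fun h hh => by simp only [g, hψ h hh]
  have h2 := hc.jump_eq hg i j
  have h3 := hψ' i
  have h4 := hψ' j
  simp only [g, h1, hj, if_true] at h2
  rw [if_neg (by linarith), if_neg (by linarith)] at h2
  norm_num at h2

/-- If `f₀` is not on the left of the cycle `c`, the indicator of the left of `c` has the unit flow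
along `c` as its coboundary. -/
theorem indicator_isLeftOf (hM : M.IsPlanarMap) (hc : M.IsCycle c) {f₀ : M.Face}
    (hf : ¬ M.IsLeftOf c f₀) (h : D) :
    (if ∃ i, c i = h then (1 : ℝ) else 0) - (if ∃ i, c i = M.opp h then 1 else 0) =
      (if M.IsLeftOf c (M.leftFace h) then 1 else 0) -
        (if M.IsLeftOf c (M.rightFace h) then 1 else 0) := by
  have hcross : ∀ h, (∀ j, M.edge (c j) ≠ M.edge h) → M.IsLeftOf c (M.leftFace h) →
      M.IsLeftOf c (M.rightFace h) := fun h hh ⟨i, hi⟩ => ⟨i, hi.tail ⟨h, hh, rfl, rfl⟩⟩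
  have hcross' : ∀ h, (∀ j, M.edge (c j) ≠ M.edge h) →
      (M.IsLeftOf c (M.leftFace h) ↔ M.IsLeftOf c (M.rightFace h)) := fun h hh =>
    ⟨hcross h hh, fun h' => by
      have := hcross (M.opp h) (by simpa only [edge_opp] using hh) h'
      rwa [rightFace_opp] at this⟩
  have hleft : ∀ i, M.IsLeftOf c (M.leftFace (c i)) := fun i => ⟨i, .refl⟩
  have hright : ∀ i, ¬ M.IsLeftOf c (M.rightFace (c i)) := by
    intro i hi
    have hall : ∀ j, M.IsLeftOf c (M.rightFace (c j)) := fun j => by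
      have := hc.jump_eq (φ := fun f => if M.IsLeftOf c f then 1 else 0)
        (fun h hh => by simp only [hcross' h hh]) i j
      simp only [hleft, hi, if_true, sub_self] at this
      by_contra hj
      simp [hj] at this
    obtain ⟨h, h1, h2⟩ := hM.exists_boundary (A := {f | M.IsLeftOf c f}) (hleft i) hf
    by_cases hh : ∀ j, M.edge (c j) ≠ M.edge h
    · exact h2 (hcross h hh h1)
    · simp only [ne_eq, not_forall, not_not, edge_eq_iff] at hh
      obtain ⟨j, rfl | rfl⟩ := hh
      · exact h2 (hall j)
      · exact h2 (by rw [rightFace_opp]; exact hleft j)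
  by_cases hh : ∀ j, M.edge (c j) ≠ M.edge h
  · obtain ⟨h2, h3⟩ := (forall_edge_ne_iff (c := c)).1 hh
    have h4 : ∀ j, c j ≠ M.opp h := fun j hj => h3 j (by rw [hj, M.opp_opp])
    simp only [h2, h4, exists_false, if_false, hcross' h hh, sub_self]
  · simp only [ne_eq, not_forall, not_not, edge_eq_iff] at hh
    obtain ⟨j, rfl | rfl⟩ := hh
    · rw [if_pos ⟨j, rfl⟩, if_neg (fun ⟨k, hk⟩ => hc.opp_ne j k hk.symm), if_pos (hleft j),
        if_neg (hright j)]
    · rw [if_neg (fun ⟨k, hk⟩ => hc.opp_ne j k hk.symm), if_pos ⟨j, by rw [M.opp_opp]⟩,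
        rightFace_opp, if_pos (hleft j)]
      change _ = (if M.IsLeftOf c (M.rightFace (c j)) then (1 : ℝ) else 0) - 1
      rw [if_neg (hright j)]

end IsCycle

theorem IsCycle.reverse {n : ℕ} {c : ZMod n → D} (hc : M.IsCycle c) :
    M.IsCycle fun i => M.opp (c (-i)) where
  pos := hc.pos
  closed i := by
    rw [M.opp_opp, ← hc.closed]
    congr 2
    ring
  vertex_inj i j hij := by
    simp only [← hc.closed] at hij
    simpa using hc.vertex_inj hij
  edge_inj i j hij := by
    simp only [edge_opp] at hij
    simpa using hc.edge_inj hij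

theorem le_girth_iff {d : ℕ} :
    (d : ℕ∞) ≤ M.girth ↔ ∀ (n : ℕ) (c : ZMod n → D), M.IsCycle c → d ≤ n := by
  simp only [girth, le_iInf_iff, Nat.cast_le, forall_exists_index]

theorem exists_isCycle_of_girth_eq {d : ℕ} (h : M.girth = d) :
    ∃ (n : ℕ) (c : ZMod n → D), M.IsCycle c := by
  by_contra! hno
  have : (⊤ : ℕ∞) ≤ M.girth := by
    simp only [girth, le_iInf_iff, forall_exists_index]
    exact fun n c hc => absurd hc (hno n c)
  rw [h] at this
  exact absurd this (not_le.2 (ENat.natCast_lt_top d))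

end CombMap

/-! ### Sparsity, and the girth of an oriented `d`-angulation -/

namespace CombMap

variable {D : Type*} {M : CombMap D} {d : ℕ} {f₀ : M.Face}

theorem IsCycle.le_card {n : ℕ} {c : ZMod n → D} (hc : M.IsCycle c) {X : Finset D}
    (hX : ∀ i, c i ∈ X) : n ≤ X.card := by
  have := hc.neZero
  calc n = (Finset.univ.image c).card := by
        rw [Finset.card_image_of_injective _ hc.injective, Finset.card_univ, ZMod.card]
    _ ≤ X.card := Finset.card_le_card (by intro h; simp only [Finset.mem_image]; grind)

/-- The cycle `c` is the contour of the face `f₀`, traversed with `f₀` on its left. -/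
structure IsContour (M : CombMap D) (f₀ : M.Face) {d : ℕ} (c : ZMod d → D) : Prop where
  isCycle : M.IsCycle c
  leftFace_eq : ∀ i, M.leftFace (c i) = f₀
  rightFace_ne : ∀ i, M.rightFace (c i) ≠ f₀
  add_one : ∀ i, c (i + 1) = M.faceNext (c i)
  exists_eq : ∀ h, M.leftFace h = f₀ → ∃ i, c i = h

namespace IsContour

variable {c : ZMod d → D}

theorem isOuterEdge_iff (hc : M.IsContour f₀ c) {h : D} :
    M.IsOuterEdge f₀ h ↔ ∃ j, M.edge (c j) = M.edge h := by
  constructor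
  · rintro (h' | h')
    · obtain ⟨i, rfl⟩ := hc.exists_eq h h'
      exact ⟨i, rfl⟩
    · obtain ⟨i, hi⟩ := hc.exists_eq _ h'
      exact ⟨i, by rw [hi, edge_opp]⟩
  · rintro ⟨j, hj⟩
    rcases M.edge_eq_iff.1 hj with rfl | rfl
    · exact Or.inl (hc.leftFace_eq j)
    · exact Or.inr (by rw [rightFace_opp]; exact hc.leftFace_eq j)

theorem isOuterVertex_iff (hc : M.IsContour f₀ c) {v : M.Vertex} :
    M.IsOuterVertex f₀ v ↔ ∃ j, M.vertex (c j) = v := by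
  constructor
  · rintro ⟨h, rfl, h'⟩
    obtain ⟨i, rfl⟩ := hc.exists_eq h h'
    exact ⟨i, rfl⟩
  · rintro ⟨j, rfl⟩
    exact ⟨c j, rfl, hc.leftFace_eq j⟩

theorem isOuterVertex_of_isOuterEdge (hc : M.IsContour f₀ c) {h : D} (hh : M.IsOuterEdge f₀ h) :
    M.IsOuterVertex f₀ (M.vertex h) := by
  obtain ⟨j, hj⟩ := hc.isOuterEdge_iff.1 hh
  rw [hc.isOuterVertex_iff]
  rcases M.edge_eq_iff.1 hj with rfl | rfl
  · exact ⟨j, rfl⟩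
  · exact ⟨j + 1, hc.isCycle.closed j⟩

end IsContour

variable [Fintype D]

theorem two_mul_sum_filter {H : D → Prop} (hH : ∀ h, H h → H (M.opp h)) (w : D → ℝ) :
    2 * ∑ h with H h, w h = ∑ h with H h, (w h + w (M.opp h)) := by
  have hH' : ∀ h, H (M.opp h) ↔ H h := fun h => ⟨fun h' => M.opp_opp h ▸ hH _ h', hH h⟩
  have := sum_comp_involution M.opp_opp fun h => if H h then w h else 0
  simp only [hH'] at this
  rw [Finset.sum_add_distrib, Finset.sum_filter, Finset.sum_filter, this, two_mul]

theorem sum_filter_vertex_mem (S : Finset M.Vertex) (w : D → ℝ) :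
    ∑ h with M.vertex h ∈ S, w h = ∑ v ∈ S, ∑ h with M.vertex h = v, w h := by
  rw [← Finset.sum_fiberwise_of_maps_to (s := Finset.univ.filter fun h => M.vertex h ∈ S)
    (t := S) (g := M.vertex) (by simp)]
  refine Finset.sum_congr rfl fun v hv => Finset.sum_congr ?_ fun _ _ => rfl
  ext h
  simp only [Finset.mem_filter, Finset.mem_univ, true_and, and_iff_right_iff_imp]
  rintro rfl
  exact hv

theorem IsAngulation.card_leftFace_eq (hM : M.IsAngulation d) (f : M.Face) :
    (Finset.univ.filter fun h => M.leftFace h = f).card = d := by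
  rw [← hM.degree f, faceDegree, Nat.card_eq_fintype_card, Fintype.card_subtype]

theorem IsAngulation.card_leftFace_mem (hM : M.IsAngulation d) (A : Finset M.Face) :
    (Finset.univ.filter fun h => M.leftFace h ∈ A).card = d * A.card := by
  rw [Finset.card_eq_sum_card_fiberwise (f := M.leftFace) (t := A) (by
    intro h hh; simpa using hh), mul_comm, ← smul_eq_mul, ← Finset.sum_const]
  refine Finset.sum_congr rfl fun f hf => ?_
  rw [← hM.card_leftFace_eq f, Finset.filter_filter]
  congr 1
  ext h
  simp only [Finset.mem_filter, Finset.mem_univ, true_and, and_iff_right_iff_imp]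
  rintro rfl
  exact hf

/-- Sparsity of induced subgraphs in a planar map of girth at least `d`: either no cycle lies in the
subgraph induced by `S`, in which case it has fewer edges than vertices, or each of its faces has at
least `d` half-edges on its boundary, and the Euler relation bounds the number of its edges.  The
number of half-edges is twice that of edges. -/
theorem IsPlanarMap.sparsity (hM : M.IsPlanarMap) (hd : (d : ℕ∞) ≤ M.girth)
    {S : Finset M.Vertex} (hS : S.Nonempty) {H : D → Prop}
    (hH : ∀ h, H h ↔ M.vertex h ∈ S ∧ M.vertex (M.opp h) ∈ S) :
    ((∀ φ : M.Face → ℝ, (∀ h, ¬ H h → φ (M.rightFace h) = φ (M.leftFace h)) →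
        ∀ x y, φ x = φ y) ∧ (Finset.univ.filter H).card + 2 ≤ 2 * S.card) ∨
      d * (Finset.univ.filter H).card + 4 * d ≤
        2 * d * S.card + 2 * (Finset.univ.filter H).card := by
  -- the faces of the subgraph
  let R := Quot fun f g : M.Face => ∃ h, ¬ H h ∧ M.leftFace h = f ∧ M.rightFace h = g
  let mk : M.Face → R := Quot.mk _
  let _ : Fintype R := Fintype.ofFinite R
  have lift_eq : ∀ φ : M.Face → ℝ, (∀ h, ¬ H h → φ (M.rightFace h) = φ (M.leftFace h)) →
      ∀ x y, mk x = mk y → φ x = φ y := by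
    intro φ hφ x y hxy
    exact congrArg (Quot.lift φ (by rintro _ _ ⟨h, hh, rfl, rfl⟩; exact (hφ h hh).symm)) hxy
  have hout : ∀ r : R, mk r.out = r := Quot.out_eq
  have heuler := hM.sphericalPair.card_add_four_le (H := H) (S := S)
    (T := Finset.univ.image (Quot.out : R → M.Face)) hS
    (fun h hh => by rw [hH, M.opp_opp]; exact ((hH h).1 hh).symm) (fun h hh => ((hH h).1 hh).1)
    (fun φ hφ hT x => by
      rw [← lift_eq φ hφ _ _ (hout (mk x))]
      exact hT _ (Finset.mem_image_of_mem _ (Finset.mem_univ _)))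
  rw [Finset.card_image_of_injective _ (Function.LeftInverse.injective (g := mk) hout),
    Finset.card_univ] at heuler
  rcases le_or_gt (Fintype.card R) 1 with hR | hR
  · refine Or.inl ⟨fun φ hφ x y => lift_eq φ hφ x y ?_, by omega⟩
    have := Fintype.card_le_one_iff_subsingleton.1 hR
    exact Subsingleton.elim _ _
  · refine Or.inr ?_
    have hdeg : d * Fintype.card R ≤ (Finset.univ.filter H).card := by
      rw [Finset.card_eq_sum_card_fiberwise (f := fun h => mk (M.leftFace h)) (t := Finset.univ)
        (by intro h _; exact Finset.mem_coe.2 (Finset.mem_univ _)), mul_comm, ← smul_eq_mul,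
        ← Finset.card_univ]
      refine Finset.card_nsmul_le_sum _ _ _ fun r _ => ?_
      have : Nontrivial R := Fintype.one_lt_card_iff_nontrivial.1 hR
      obtain ⟨r', hr'⟩ := exists_ne r
      obtain ⟨h, hl, hr⟩ := hM.exists_boundary (A := {f | mk f = r}) (f := r.out) (g := r'.out)
        (hout r) (by rw [Set.mem_ofPred_eq, hout]; exact hr')
      obtain ⟨n, c, hc, hcA⟩ := exists_isCycle_of_boundary hl hr
      refine (le_girth_iff.1 hd n c hc).trans (hc.le_card fun i => ?_)
      obtain ⟨h1, h2⟩ := hcA i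
      simp only [Finset.mem_filter, Finset.mem_univ, true_and]
      refine ⟨?_, h1⟩
      by_contra hH'
      exact h2 ((Quot.sound ⟨c i, hH', rfl, rfl⟩ : mk _ = mk _).symm.trans h1)
    have := Nat.mul_le_mul_left d heuler
    linarith

/-- The weights of a `d/(d-2)`-orientation. -/
structure IsDWeight (M : CombMap D) (d : ℕ) (f₀ : M.Face) (w : D → ℝ) : Prop where
  nat : ∀ h, ∃ k : ℕ, w h = k
  innerEdge : ∀ h, ¬ M.IsOuterEdge f₀ h → w h + w (M.opp h) = (d : ℝ) - 2
  innerVertex : ∀ v, ¬ M.IsOuterVertex f₀ v → ∑ h with M.vertex h = v, w h = d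
  outerEdge : ∀ h, M.IsOuterEdge f₀ h → w h + w (M.opp h) = 1
  outerVertex : ∀ v, M.IsOuterVertex f₀ v → ∑ h with M.vertex h = v, w h = 1

namespace IsDWeight

variable {w : D → ℝ}

theorem nonneg (hw : M.IsDWeight d f₀ w) (h : D) : 0 ≤ w h := by
  obtain ⟨k, hk⟩ := hw.nat h
  rw [hk]
  positivity

theorem one_le_of_pos (hw : M.IsDWeight d f₀ w) {h : D} (hh : 0 < w h) : 1 ≤ w h := by
  obtain ⟨k, hk⟩ := hw.nat h
  rw [hk] at hh ⊢
  exact_mod_cast hh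

/-- Cycles have length at least `d`.  In the region of the complement of the cycle `c` that does not
contain the root-face, count vertices, edges and faces: the weights of the edges must cover those of
the vertices strictly inside. -/
theorem le_length (hM : M.IsAngulation d) (hw : M.IsDWeight d f₀ w) {n : ℕ} {c : ZMod n → D}
    (hc : M.IsCycle c) : d ≤ n := by
  obtain ⟨ψ, hψ, hψ'⟩ := hc.exists_index hM.planar
  obtain ⟨f, hf⟩ : ∃ f, ψ f ≠ ψ f₀ := by
    by_contra! hall
    have := hψ' 0
    rw [hall (M.leftFace _), hall (M.rightFace _)] at this
    linarith
  have hψc : ∀ h, (∃ j, M.edge (c j) = M.edge h) → ψ (M.leftFace h) ≠ ψ (M.rightFace h) := by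
    rintro h ⟨j, hj⟩
    rcases M.edge_eq_iff.1 hj with rfl | rfl
    · rw [hψ']; simp
    · rw [rightFace_opp, hψ']; exact (lt_add_one _).ne
  set A : Finset M.Face := Finset.univ.filter fun g => ψ g = ψ f with hA
  have memA : ∀ g, g ∈ A ↔ ψ g = ψ f := by simp [hA]
  have hf₀ : f₀ ∉ A := fun h => hf ((memA _).1 h).symm
  obtain ⟨H, hH⟩ : ∃ H : D → Prop, ∀ h, H h ↔ M.leftFace h ∈ A ∧ M.rightFace h ∈ A :=
    ⟨_, fun _ => Iff.rfl⟩
  have hHopp : ∀ h, H h → H (M.opp h) := fun h hh => by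
    rw [hH, rightFace_opp]
    exact ((hH h).1 hh).symm
  set I : Finset M.Vertex := Finset.univ.filter fun v =>
    (∀ h, M.vertex h = v → M.leftFace h ∈ A) ∧ ∀ j, M.vertex (c j) ≠ v with hI
  have memI : ∀ v, v ∈ I ↔ (∀ h, M.vertex h = v → M.leftFace h ∈ A) ∧
    ∀ j, M.vertex (c j) ≠ v := by simp [hI]
  -- edges incident to a vertex off the cycle are off the cycle
  have hoff : ∀ h, (∀ j, M.vertex (c j) ≠ M.vertex h) → ∀ j, M.edge (c j) ≠ M.edge h := by
    intro h hh j hj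
    rcases M.edge_eq_iff.1 hj with rfl | rfl
    · exact hh j rfl
    · exact hh (j + 1) (hc.closed j)
  have heuler := hM.planar.sphericalPair.symm.card_add_four_le (H := H) (S := A)
    (T := insert (M.vertex (c 0)) I) ⟨f, (memA f).2 rfl⟩ hHopp (fun h hh => ((hH h).1 hh).1) (by
      intro p hp hT
      have hcyc : ∀ j, p (M.vertex (c j)) = 0 := fun j => by
        rw [← hT _ (Finset.mem_insert_self _ _)]
        refine hc.const_of_add_one (f := fun j => p (M.vertex (c j))) (fun i => ?_) j 0
        simp only [hc.closed]
        refine hp _ fun hh => hψc (c i) ⟨i, rfl⟩ ?_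
        rw [(memA _).1 ((hH _).1 hh).1, (memA _).1 ((hH _).1 hh).2]
      have hzero : ∀ h, M.leftFace h ∈ A → p (M.vertex h) = 0 := by
        intro h hh
        by_cases hv : ∃ j, M.vertex (c j) = M.vertex h
        · obtain ⟨j, hj⟩ := hv
          rw [← hj, hcyc]
        · push Not at hv
          refine hT _ (Finset.mem_insert_of_mem ((memI _).2 ⟨fun g hg => ?_, hv⟩))
          refine (M.of_vertex_eq (p := fun g => M.vertex g = M.vertex h ∧ M.leftFace g ∈ A)
            (fun g hg => ⟨(M.vertex_next g).trans hg.1, ?_⟩) hg.symm ⟨rfl, hh⟩).2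
          rw [leftFace_next, memA, ← hψ g (hoff g (by simpa only [hg.1] using hv))]
          exact (memA _).1 hg.2
      intro x
      rw [hM.planar.sphericalPair.const_left p (fun h => ?_) x (M.vertex (c 0)), hcyc]
      by_cases hh : H h
      · rw [hzero h ((hH h).1 hh).1, hzero (M.opp h) ((hH h).1 hh).2]
      · exact hp h hh)
  rw [Finset.card_insert_of_notMem fun h => ((memI _).1 h).2 0 rfl] at heuler
  -- a half-edge with the region on its left has it on its right too, or belongs to the cycle
  have hfaces : d * A.card ≤ (Finset.univ.filter H).card + n := by
    set B := Finset.univ.filter fun h => M.leftFace h ∈ A ∧ M.rightFace h ∉ A with hB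
    have h1 : (Finset.univ.filter H).card + B.card = d * A.card := by
      simp only [hH]
      rw [← hM.card_leftFace_mem A, hB, ← Finset.filter_filter, ← Finset.filter_filter,
        Finset.card_filter_add_card_filter_not]
    have h2 : B.card + B.card ≤ 2 * n := by
      rw [← hc.card_halfEdges]
      nth_rewrite 2 [← Finset.card_image_of_injective B M.opp.injective]
      have hBc : ∀ h ∈ B, ∃ j, M.edge (c j) = M.edge h := by
        intro h hh
        simp only [hB, Finset.mem_filter, Finset.mem_univ, true_and, memA] at hh
        by_contra! hno
        exact hh.2 ((hψ h hno).symm.trans hh.1)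
      rw [← Finset.card_union_of_disjoint]
      · refine Finset.card_le_card fun h hh => ?_
        simp only [Finset.mem_filter, Finset.mem_univ, true_and]
        rcases Finset.mem_union.1 hh with hh | hh
        · exact hBc h hh
        · obtain ⟨g, hg, rfl⟩ := Finset.mem_image.1 hh
          simpa only [edge_opp] using hBc g hg
      · rw [Finset.disjoint_left]
        intro h hh hh'
        obtain ⟨g, hg, rfl⟩ := Finset.mem_image.1 hh'
        simp only [hB, Finset.mem_filter, Finset.mem_univ, true_and] at hh hg
        exact hg.2 hh.1
    omega
  have hweights : 2 * ((d : ℝ) * I.card) ≤ (Finset.univ.filter H).card * ((d : ℝ) - 2) := by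
    have h1 : (d : ℝ) * I.card = ∑ h with M.vertex h ∈ I, w h := by
      rw [sum_filter_vertex_mem, mul_comm, ← nsmul_eq_mul, ← Finset.sum_const]
      refine Finset.sum_congr rfl fun v hv => (hw.innerVertex v ?_).symm
      rintro ⟨h, rfl, hh⟩
      exact hf₀ (hh ▸ ((memI _).1 hv).1 h rfl)
    have h2 : ∑ h with M.vertex h ∈ I, w h ≤ ∑ h with H h, w h := by
      refine Finset.sum_le_sum_of_subset_of_nonneg (fun h hh => ?_) fun h _ _ => hw.nonneg h
      simp only [Finset.mem_filter, Finset.mem_univ, true_and] at hh ⊢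
      refine (hH h).2 ⟨((memI _).1 hh).1 h rfl, ?_⟩
      rw [← leftFace_next]
      exact ((memI _).1 hh).1 _ (M.vertex_next h)
    have h3 : 2 * ∑ h with H h, w h = (Finset.univ.filter H).card * ((d : ℝ) - 2) := by
      rw [two_mul_sum_filter hHopp, ← nsmul_eq_mul, ← Finset.sum_const]
      refine Finset.sum_congr rfl fun h hh => hw.innerEdge h ?_
      have hh := (hH h).1 (Finset.mem_filter.1 hh).2
      rintro (h' | h')
      · exact hf₀ (h' ▸ hh.1)
      · exact hf₀ (h' ▸ hh.2)
    linarith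
  have heuler' : ((Finset.univ.filter H).card : ℝ) + 4 ≤ 2 * A.card + 2 * (I.card + 1) := by
    exact_mod_cast heuler
  have hfaces' : (d : ℝ) * A.card ≤ (Finset.univ.filter H).card + n := by exact_mod_cast hfaces
  have := mul_le_mul_of_nonneg_left heuler' (Nat.cast_nonneg (α := ℝ) d)
  have : (d : ℝ) ≤ n := by linarith
  exact_mod_cast this

/-- There is a face other than the root-face: otherwise the map is a plane tree and has one more
vertex than edges, while the total weight is equal to both numbers. -/
theorem exists_face_ne (hM : M.IsPlanarMap) (hw : M.IsDWeight d f₀ w) : ∃ f, f ≠ f₀ := by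
  by_contra! hall
  have h1 : ∑ h, w h = Fintype.card M.Vertex := by
    have := sum_filter_vertex_mem (M := M) Finset.univ w
    simp only [Finset.mem_univ, Finset.filter_true] at this
    rw [this, ← Finset.card_univ, Finset.cast_card]
    refine Finset.sum_congr rfl fun v _ => hw.outerVertex v ?_
    obtain ⟨h, rfl⟩ := M.vertex_surjective v
    exact ⟨h, rfl, hall _⟩
  have h2 : 2 * ∑ h, w h = Fintype.card D := by
    have := two_mul_sum_filter (M := M) (H := fun _ => True) (by simp) w
    simp only [Finset.filter_true] at this
    rw [this, ← Finset.card_univ, Finset.cast_card]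
    exact Finset.sum_congr rfl fun h _ => hw.outerEdge h (Or.inl (hall _))
  have h3 : Fintype.card M.Face = 1 := Fintype.card_eq_one_iff.2 ⟨f₀, hall⟩
  have h4 := hM.sphericalPair.euler
  rw [h1] at h2
  have h5 : 2 * Fintype.card M.Vertex = Fintype.card D := by exact_mod_cast h2
  omega

theorem girth_eq (hM : M.IsAngulation d) (hw : M.IsDWeight d f₀ w) : M.girth = d := by
  refine le_antisymm ?_ (le_girth_iff.2 fun n c hc => hw.le_length hM hc)
  obtain ⟨f, hf⟩ := hw.exists_face_ne hM.planar
  obtain ⟨h, hl, hr⟩ := hM.planar.exists_boundary (A := {f₀}) rfl hf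
  obtain ⟨n, c, hc, hcA⟩ := exists_isCycle_of_boundary hl hr
  calc M.girth ≤ n := iInf₂_le n ⟨c, hc⟩
    _ ≤ d := by
      rw [← hM.card_leftFace_eq f₀]
      exact_mod_cast hc.le_card fun i => by simpa using (hcA i).1

end IsDWeight

/-- In a `d`-angulation of girth `d` every face is bounded by a simple cycle: the boundary of the
face contains a cycle, which has at most `d` edges. -/
theorem IsAngulation.exists_isContour (hM : M.IsAngulation d) (hg : M.girth = d) (f₀ : M.Face) :
    ∃ c : ZMod d → D, M.IsContour f₀ c := by
  obtain ⟨f, hf⟩ : ∃ f, f ≠ f₀ := by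
    by_contra! hall
    obtain ⟨n, c, hc⟩ := exists_isCycle_of_girth_eq hg
    obtain ⟨ψ, -, hψ⟩ := hc.exists_index hM.planar
    have := hψ 0
    rw [hall (M.leftFace _), hall (M.rightFace _)] at this
    linarith
  obtain ⟨h, hl, hr⟩ := hM.planar.exists_boundary (A := {f₀}) rfl hf
  obtain ⟨n, c, hc, hcA⟩ := exists_isCycle_of_boundary hl hr
  obtain rfl : n = d := by
    refine le_antisymm ?_ (le_girth_iff.1 hg.ge n c hc)
    rw [← hM.card_leftFace_eq f₀]
    exact hc.le_card fun i => by simpa using (hcA i).1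
  have := hc.neZero
  have hex : ∀ h, M.leftFace h = f₀ → ∃ i, c i = h := by
    intro h hh
    have himage : Finset.univ.image c = Finset.univ.filter fun h => M.leftFace h = f₀ := by
      refine Finset.eq_of_subset_of_card_le (fun g hg => ?_) ?_
      · obtain ⟨i, -, rfl⟩ := Finset.mem_image.1 hg
        simpa using (hcA i).1
      · rw [hM.card_leftFace_eq, Finset.card_image_of_injective _ hc.injective, Finset.card_univ,
          ZMod.card]
    have : h ∈ Finset.univ.image c := by rw [himage]; simpa using hh
    simpa using this
  refine ⟨c, hc, fun i => (hcA i).1, fun i => (hcA i).2, fun i => ?_, hex⟩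
  obtain ⟨j, hj⟩ := hex (M.faceNext (c i)) (by rw [leftFace_faceNext]; exact (hcA i).1)
  rw [← hj]
  refine congrArg c (hc.vertex_inj ?_)
  simp only [hj, vertex_faceNext, hc.closed]

namespace IsContour

variable {c : ZMod d → D}

theorem card_isOuterEdge (hc : M.IsContour f₀ c) :
    (Finset.univ.filter fun h => M.IsOuterEdge f₀ h).card = 2 * d := by
  simp only [hc.isOuterEdge_iff, hc.isCycle.card_halfEdges]

theorem card_isOuterVertex (hc : M.IsContour f₀ c) :
    (Finset.univ.filter fun v => M.IsOuterVertex f₀ v).card = d := by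
  have := hc.isCycle.neZero
  have h1 : (Finset.univ.filter fun v => M.IsOuterVertex f₀ v) =
      Finset.univ.image fun i => M.vertex (c i) := by
    ext v
    simp [hc.isOuterVertex_iff]
  rw [h1, Finset.card_image_of_injective _ hc.isCycle.vertex_inj, Finset.card_univ, ZMod.card]

end IsContour

end CombMap

/-! ### Existence of orientations -/

/-- A form of Hakimi's theorem, deduced from Hall's theorem.  The half-edges of a graph (with
endpoint map `v`) can be given natural weights with prescribed sums `β` on edges and `α` at vertices
as soon as the two totals agree and the edges induced by any set of vertices have total weight at
most that of the set.  Sums over half-edges count every edge twice. -/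
theorem exists_weight_of_sum_le {D V : Type*} [Fintype D] [Fintype V] {opp : D → D}
    (h2 : ∀ h, opp (opp h) = h) (hne : ∀ h, opp h ≠ h) (v : D → V) (α : V → ℕ) (β : D → ℕ)
    (hβ : ∀ h, β (opp h) = β h)
    (hle : ∀ S : Finset V, ∑ h with v h ∈ S ∧ v (opp h) ∈ S, β h ≤ 2 * ∑ x ∈ S, α x)
    (htot : ∑ h, β h = 2 * ∑ x, α x) :
    ∃ w : D → ℕ, (∀ h, w h + w (opp h) = β h) ∧ ∀ x, ∑ h with v h = x, w h = α x := by
  obtain ⟨P, hP⟩ := exists_orientation h2 hne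
  -- match the units of weight of the edges to the units of weight of their endpoints
  let t : (Σ h : P, Fin (β h)) → Finset (Σ x : V, Fin (α x)) := fun u =>
    Finset.univ.filter fun s => s.1 = v u.1 ∨ s.1 = v (opp u.1)
  have hcardP : ∀ (Q : D → Prop) [DecidablePred Q],
      (Finset.univ.filter fun u : Σ h : P, Fin (β h) => Q u.1).card =
        ∑ h ∈ P, if Q h then β h else 0 := by
    intro Q _
    have : (Finset.univ.filter fun u : Σ h : P, Fin (β h) => Q u.1) =
        (Finset.univ.filter fun h : P => Q h).sigma fun _ => Finset.univ := by
      ext u; simp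
    rw [this, Finset.card_sigma, ← Finset.sum_coe_sort P, Finset.sum_filter]
    simp
  have hcardV : ∀ S : Finset V,
      (Finset.univ.filter fun s : Σ x : V, Fin (α x) => s.1 ∈ S).card = ∑ x ∈ S, α x := by
    intro S
    have : (Finset.univ.filter fun s : Σ x : V, Fin (α x) => s.1 ∈ S) =
        S.sigma fun _ => Finset.univ := by
      ext u; simp
    rw [this, Finset.card_sigma]
    simp
  have hall : ∀ s : Finset (Σ h : P, Fin (β h)), s.card ≤ (s.biUnion t).card := by
    intro s
    set S : Finset V := s.image (fun u => v u.1) ∪ s.image fun u => v (opp u.1) with hS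
    have h1 : s.biUnion t = Finset.univ.filter fun x => x.1 ∈ S := by
      ext x
      simp only [t, hS, Finset.mem_biUnion, Finset.mem_filter, Finset.mem_univ, true_and,
        Finset.mem_union, Finset.mem_image, ← exists_or, ← and_or_left, @eq_comm _ x.1]
    have h4 : s.card ≤ ∑ h ∈ P, if v h ∈ S ∧ v (opp h) ∈ S then β h else 0 := by
      refine (Finset.card_le_card fun u hu => ?_).trans_eq
        (hcardP fun h => v h ∈ S ∧ v (opp h) ∈ S)
      simp only [hS, Finset.mem_filter, Finset.mem_univ, true_and, Finset.mem_union,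
        Finset.mem_image]
      exact ⟨Or.inl ⟨u, hu, rfl⟩, Or.inr ⟨u, hu, rfl⟩⟩
    have h5 := hle S
    rw [Finset.sum_filter, sum_eq_sum_orientation h2 hP] at h5
    simp only [h2, hβ, and_comm (a := v (opp _) ∈ S), ← two_mul, ← Finset.mul_sum] at h5
    rw [h1, hcardV]
    omega
  obtain ⟨f, hf, hft⟩ := (Finset.all_card_le_biUnion_card_iff_exists_injective t).1 hall
  let g : (Σ h : P, Fin (β h)) → D := fun u => if (f u).1 = v u.1 then u.1 else opp u.1
  have hvg : ∀ u, v (g u) = (f u).1 := by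
    intro u
    have := hft u
    simp only [t, Finset.mem_filter, Finset.mem_univ, true_and] at this
    simp only [g]
    split_ifs with h
    · exact h.symm
    · exact (this.resolve_left h).symm
  let w : D → ℕ := fun h => (Finset.univ.filter fun u => g u = h).card
  have hedge : ∀ h ∈ P, w h + w (opp h) = β h := by
    intro h hh
    have h3 := hcardP fun x => x = h
    rw [Finset.sum_ite_eq' P h, if_pos hh] at h3
    rw [← h3]
    simp only [w]
    rw [← Finset.card_union_of_disjoint]
    · congr 1
      ext u
      have hu : u.1.1 ≠ opp h := fun h' => (hP h).1 (h' ▸ u.1.2) hh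
      have hu' : opp u.1.1 ≠ h := fun h' => hu (by rw [← h', h2])
      simp only [Finset.mem_union, Finset.mem_filter, Finset.mem_univ, true_and, g]
      split_ifs
      · simp [hu]
      · simp only [hu', false_or]
        exact ⟨fun h' => by rw [← h2 u.1.1, h', h2], fun h' => by rw [h']⟩
    · rw [Finset.disjoint_left]
      intro u hu hu'
      simp only [Finset.mem_filter, Finset.mem_univ, true_and] at hu hu'
      exact hne h (hu'.symm.trans hu)
  have hedge' : ∀ h, w h + w (opp h) = β h := by
    intro h
    by_cases hh : h ∈ P
    · exact hedge h hh
    · have := hedge _ ((hP h).2 hh)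
      rwa [h2, hβ, add_comm] at this
  have hvertex : ∀ x, ∑ h with v h = x, w h ≤ α x := by
    intro x
    have h3 : ∑ h with v h = x, w h = (Finset.univ.filter fun u => (f u).1 = x).card := by
      rw [Finset.card_eq_sum_card_fiberwise (f := g) (t := Finset.univ.filter fun h => v h = x)
        (by intro u hu; simpa [hvg] using hu)]
      refine Finset.sum_congr rfl fun h hh => ?_
      simp only [w, Finset.filter_filter]
      congr 1
      ext u
      simp only [Finset.mem_filter, Finset.mem_univ, true_and] at hh ⊢
      refine ⟨fun hu => ⟨?_, hu⟩, fun hu => hu.2⟩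
      rw [← hvg, hu, hh]
    have h4 := hcardV {x}
    rw [Finset.sum_singleton] at h4
    rw [h3, ← h4, ← Finset.card_image_of_injective _ hf]
    refine Finset.card_le_card fun s hs => ?_
    obtain ⟨u, hu, rfl⟩ := Finset.mem_image.1 hs
    simpa using hu
  refine ⟨w, hedge', ?_⟩
  have hsum : ∑ x, ∑ h with v h = x, w h = ∑ x, α x := by
    have h3 : ∑ h, (w h + w (opp h)) = 2 * ∑ h, w h := by
      rw [Finset.sum_add_distrib, two_mul]
      congr 1
      exact Fintype.sum_equiv ⟨opp, opp, h2, h2⟩ _ _ fun _ => rfl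
    simp only [hedge', htot] at h3
    exact (Finset.sum_fiberwise Finset.univ v w).trans (by omega)
  exact fun x => (Finset.sum_eq_sum_iff_of_le fun x _ => hvertex x).1 hsum x (Finset.mem_univ x)

namespace CombMap

variable {D : Type*} [Fintype D] {M : CombMap D} {d : ℕ} {f₀ : M.Face}

/-- At most two outer half-edges are incident to each outer vertex. -/
theorem IsContour.card_filter_isOuterEdge_le {c : ZMod d → D} (hc : M.IsContour f₀ c)
    (S : Finset M.Vertex) :
    (Finset.univ.filter fun h => M.IsOuterEdge f₀ h ∧ M.vertex h ∈ S).card ≤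
      2 * (S.filter fun v => M.IsOuterVertex f₀ v).card := by
  refine (Finset.card_le_mul_card_image (f := M.vertex) _ 2 fun v hv => ?_).trans
    (Nat.mul_le_mul_left 2 (Finset.card_le_card fun v hv => ?_))
  · obtain ⟨g, hg, rfl⟩ := Finset.mem_image.1 hv
    simp only [Finset.mem_filter, Finset.mem_univ, true_and] at hg
    obtain ⟨j, hj⟩ := hc.isOuterVertex_iff.1 (hc.isOuterVertex_of_isOuterEdge hg.1)
    refine (Finset.card_le_card fun h hh => ?_).trans
      (Finset.card_le_two (a := c j) (b := M.opp (c (j - 1))))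
    simp only [Finset.mem_filter, Finset.mem_univ, true_and] at hh
    simpa using hc.isCycle.eq_or_eq_of_vertex_eq (hh.2.trans hj.symm)
      (hc.isOuterEdge_iff.1 hh.1.1)
  · obtain ⟨g, hg, rfl⟩ := Finset.mem_image.1 hv
    simp only [Finset.mem_filter, Finset.mem_univ, true_and] at hg ⊢
    exact ⟨hg.2, hc.isOuterVertex_of_isOuterEdge hg.1⟩

/-- A `d`-angulation of girth `d` has a `d/(d-2)`-orientation.  In the criterion
`exists_weight_of_sum_le` one can add to the set `S` all the outer vertices, and then apply
sparsity. -/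
theorem IsAngulation.exists_isDWeight (hM : M.IsAngulation d) (hd : 3 ≤ d) (hg : M.girth = d) :
    ∃ w, M.IsDWeight d f₀ w := by
  obtain ⟨e, rfl⟩ := Nat.exists_eq_add_of_le' hd
  obtain ⟨c, hc⟩ := hM.exists_isContour hg f₀
  obtain ⟨α, hα⟩ : ∃ α : M.Vertex → ℕ, ∀ v, α v = if M.IsOuterVertex f₀ v then 1 else e + 3 :=
    ⟨_, fun _ => rfl⟩
  obtain ⟨β, hβ⟩ : ∃ β : D → ℕ, ∀ h, β h = if M.IsOuterEdge f₀ h then 1 else e + 1 :=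
    ⟨_, fun _ => rfl⟩
  have houter : ∀ h, M.IsOuterEdge f₀ (M.opp h) ↔ M.IsOuterEdge f₀ h := fun h => by
    rw [IsOuterEdge, IsOuterEdge, rightFace_opp, or_comm]; rfl
  -- total weights, when all outer vertices and edges are taken
  have hαsum : ∀ S : Finset M.Vertex, (∀ v, M.IsOuterVertex f₀ v → v ∈ S) →
      ∑ v ∈ S, α v + (e + 2) * (e + 3) = (e + 3) * S.card := by
    intro S hS
    have h1 : ∑ v ∈ S, (α v + if M.IsOuterVertex f₀ v then e + 2 else 0) = (e + 3) * S.card := by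
      rw [mul_comm, ← smul_eq_mul, ← Finset.sum_const]
      refine Finset.sum_congr rfl fun v _ => ?_
      rw [hα]; split_ifs <;> omega
    have h2 : S.filter (fun v => M.IsOuterVertex f₀ v) =
        Finset.univ.filter fun v => M.IsOuterVertex f₀ v := by
      ext v; simpa using hS v
    rw [Finset.sum_add_distrib, ← Finset.sum_filter, Finset.sum_const, h2, hc.card_isOuterVertex,
      smul_eq_mul] at h1
    linarith
  have hβsum : ∀ H : D → Prop, (∀ h, M.IsOuterEdge f₀ h → H h) →
      ∑ h with H h, β h + 2 * e * (e + 3) = (e + 1) * (Finset.univ.filter H).card := by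
    intro H hH
    have h1 : ∑ h with H h, (β h + if M.IsOuterEdge f₀ h then e else 0) =
        (e + 1) * (Finset.univ.filter H).card := by
      rw [mul_comm, ← smul_eq_mul, ← Finset.sum_const]
      refine Finset.sum_congr rfl fun v _ => ?_
      rw [hβ]; split_ifs <;> omega
    have h2 : (Finset.univ.filter H).filter (fun h => M.IsOuterEdge f₀ h) =
        Finset.univ.filter fun h => M.IsOuterEdge f₀ h := by
      ext v; simpa using hH v
    rw [Finset.sum_add_distrib, ← Finset.sum_filter, Finset.sum_const, h2, hc.card_isOuterEdge,
      smul_eq_mul] at h1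
    linarith
  have hbig : ∀ S : Finset M.Vertex, (∀ v, M.IsOuterVertex f₀ v → v ∈ S) →
      ∑ h with M.vertex h ∈ S ∧ M.vertex (M.opp h) ∈ S, β h ≤ 2 * ∑ v ∈ S, α v := by
    intro S hS
    have hH : ∀ h, M.IsOuterEdge f₀ h → M.vertex h ∈ S ∧ M.vertex (M.opp h) ∈ S := fun h hh =>
      ⟨hS _ (hc.isOuterVertex_of_isOuterEdge hh),
        hS _ (hc.isOuterVertex_of_isOuterEdge ((houter h).2 hh))⟩
    obtain ⟨H, hHdef⟩ : ∃ H : D → Prop, ∀ h, H h ↔ M.vertex h ∈ S ∧ M.vertex (M.opp h) ∈ S :=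
      ⟨_, fun _ => Iff.rfl⟩
    have h1 := hαsum S hS
    have h2 := hβsum H fun h hh => (hHdef h).2 (hH h hh)
    rcases hM.planar.sparsity hg.ge ⟨_, hS _ (hc.isOuterVertex_iff.2 ⟨0, rfl⟩)⟩ hHdef with
      ⟨h3, -⟩ | h3
    · have := h3 (fun f => if f = f₀ then 1 else 0) (fun h hh => by
        rw [hHdef] at hh
        rw [if_neg fun h' => hh (hH h (Or.inr h')), if_neg fun h' => hh (hH h (Or.inl h'))])
        f₀ (M.rightFace (c 0))
      simp [hc.rightFace_ne] at this
    · simp only [hHdef] at h2 h3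
      nlinarith
  have hle : ∀ S : Finset M.Vertex,
      ∑ h with M.vertex h ∈ S ∧ M.vertex (M.opp h) ∈ S, β h ≤ 2 * ∑ v ∈ S, α v := by
    intro S
    set O := Finset.univ.filter fun v => M.IsOuterVertex f₀ v with hO
    have h1 := hbig (S ∪ O) (fun v hv => Finset.mem_union_right _ (by simpa [hO] using hv))
    -- adding the missing outer vertices
    have h2 : ∑ v ∈ S ∪ O, α v + (S.filter fun v => M.IsOuterVertex f₀ v).card =
        ∑ v ∈ S, α v + (e + 3) := by
      have h3 : S.filter (fun v => M.IsOuterVertex f₀ v) = S ∩ O := by ext v; simp [hO]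
      have h4 : ∀ T ⊆ O, ∑ v ∈ T, α v = T.card := by
        intro T hT
        rw [Finset.card_eq_sum_ones]
        refine Finset.sum_congr rfl fun v hv => ?_
        rw [hα, if_pos (by simpa [hO] using hT hv)]
      rw [h3, ← h4 _ Finset.inter_subset_right, Finset.sum_union_inter, h4 O subset_rfl,
        hc.card_isOuterVertex]
    have h5 : ∑ h with M.vertex h ∈ S ∧ M.vertex (M.opp h) ∈ S, β h + 2 * (e + 3) ≤
        ∑ h with M.vertex h ∈ S ∪ O ∧ M.vertex (M.opp h) ∈ S ∪ O, β h +
          2 * (S.filter fun v => M.IsOuterVertex f₀ v).card := by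
      set A := Finset.univ.filter fun h => M.vertex h ∈ S ∧ M.vertex (M.opp h) ∈ S with hA
      set E := Finset.univ.filter fun h => M.IsOuterEdge f₀ h with hE
      have h6 : ∀ T ⊆ E, ∑ h ∈ T, β h = T.card := by
        intro T hT
        rw [Finset.card_eq_sum_ones]
        refine Finset.sum_congr rfl fun h hh => ?_
        rw [hβ, if_pos (by simpa [hE] using hT hh)]
      have h7 : ∑ h ∈ A ∪ E, β h ≤
          ∑ h with M.vertex h ∈ S ∪ O ∧ M.vertex (M.opp h) ∈ S ∪ O, β h := by
        refine Finset.sum_le_sum_of_subset fun h hh => ?_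
        simp only [hA, hE, hO, Finset.mem_union, Finset.mem_filter, Finset.mem_univ, true_and]
          at hh ⊢
        rcases hh with hh | hh
        · exact ⟨Or.inl hh.1, Or.inl hh.2⟩
        · exact ⟨Or.inr (hc.isOuterVertex_of_isOuterEdge hh),
            Or.inr (hc.isOuterVertex_of_isOuterEdge ((houter h).2 hh))⟩
      have h8 : (A ∩ E).card ≤ 2 * (S.filter fun v => M.IsOuterVertex f₀ v).card := by
        refine (Finset.card_le_card fun h hh => ?_).trans (hc.card_filter_isOuterEdge_le S)
        simp only [hA, hE, Finset.mem_inter, Finset.mem_filter, Finset.mem_univ, true_and] at hh ⊢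
        exact ⟨hh.2, hh.1.1⟩
      have h9 := Finset.sum_union_inter (s₁ := A) (s₂ := E) (f := β)
      rw [h6 E subset_rfl, h6 _ Finset.inter_subset_right, hE, hc.card_isOuterEdge, ← hE] at h9
      omega
    omega
  have htot : ∑ h, β h = 2 * ∑ v, α v := by
    have h1 := hαsum Finset.univ (fun v _ => Finset.mem_univ v)
    have h2 := hβsum (fun _ => True) (fun _ _ => trivial)
    have h3 := hM.card_leftFace_mem Finset.univ
    have h4 := hM.planar.sphericalPair.euler
    simp only [Finset.filter_true, Finset.mem_univ, Finset.card_univ] at h1 h2 h3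
    zify at h1 h2 h3 h4 ⊢
    linear_combination h2 - 2 * h1 - (e + 3 : ℤ) * h4 - 2 * h3
  obtain ⟨w, hw, hw'⟩ := exists_weight_of_sum_le M.opp_opp M.opp_ne M.vertex α β
    (fun h => by rw [hβ, hβ]; simp only [houter]) hle htot
  have hwR : ∀ h, (w h : ℝ) + w (M.opp h) = β h := fun h => by exact_mod_cast hw h
  have hwR' : ∀ v, ∑ h with M.vertex h = v, (w h : ℝ) = α v := fun v => by exact_mod_cast hw' v
  refine ⟨fun h => w h, fun h => ⟨_, rfl⟩, fun h hh => ?_, fun v hv => ?_, fun h hh => ?_,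
    fun v hv => ?_⟩
  · rw [hwR, hβ, if_neg hh]; push_cast; ring
  · rw [hwR', hα, if_neg hv]
  · rw [hwR, hβ, if_pos hh]; simp
  · rw [hwR', hα, if_pos hv]; simp

end CombMap

/-! ### Minimal orientations -/

open CombMap

namespace WeightedBiorientation

variable {D : Type*} {M : CombMap D}

/-- The biorientation whose ingoing half-edges are those of positive weight. -/
def ofWeight (M : CombMap D) (w : D → ℝ) : WeightedBiorientation M := ⟨fun h => 0 < w h, w⟩

theorem ofWeight_traversable {w : D → ℝ} {h : D} :
    (ofWeight M w).Traversable h ↔ 0 < w (M.opp h) := by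
  simp only [Traversable, TwoWay, OneWayAlong, ofWeight]
  tauto

variable {O : WeightedBiorientation M}

theorem IsNat.nonneg (hO : O.IsNat) (h : D) : 0 ≤ O.weight h := by
  obtain ⟨k, hk⟩ := hO.nat h
  rw [hk]
  positivity

theorem IsNat.eq_ofWeight (hO : O.IsNat) : O = ofWeight M O.weight := by
  ext h
  · refine ⟨hO.ingoing_pos h, fun hh => ?_⟩
    by_contra hin
    exact absurd hh (not_lt.2 (hO.outgoing_nonpos h hin))
  · rfl

variable [Fintype D] {d : ℕ} {f₀ : M.Face}

theorem IsNat.vertexWeight_eq (hO : O.IsNat) (v : M.Vertex) :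
    O.vertexWeight v = ∑ h with M.vertex h = v, O.weight h := by
  refine Finset.sum_subset (fun h hh => ?_) fun h hh hh' => ?_
  · simp only [Finset.mem_filter, Finset.mem_univ, true_and] at hh ⊢
    exact hh.1
  · simp only [Finset.mem_filter, Finset.mem_univ, true_and] at hh hh'
    exact le_antisymm (hO.outgoing_nonpos h fun hin => hh' ⟨hh, hin⟩) (hO.nonneg h)

theorem IsDOrientation.isDWeight (hO : O.IsDOrientation d f₀) : M.IsDWeight d f₀ O.weight where
  nat := hO.nat.nat
  innerEdge := hO.innerEdge
  innerVertex v hv := by rw [← hO.nat.vertexWeight_eq, hO.innerVertex v hv]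
  outerEdge := hO.outerEdge
  outerVertex v hv := by rw [← hO.nat.vertexWeight_eq, hO.outerVertex v hv]

theorem isDOrientation_ofWeight {w : D → ℝ} (hw : M.IsDWeight d f₀ w) :
    (ofWeight M w).IsDOrientation d f₀ := by
  have hN : (ofWeight M w).IsNat := ⟨fun _ hh => hh, fun _ hh => not_lt.1 hh, hw.nat⟩
  exact ⟨hN, hw.innerEdge, fun v hv => by rw [hN.vertexWeight_eq]; exact hw.innerVertex v hv,
    hw.outerEdge, fun v hv => by rw [hN.vertexWeight_eq]; exact hw.outerVertex v hv⟩

end WeightedBiorientation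

open WeightedBiorientation

namespace CombMap

variable {D : Type*} [Fintype D] {M : CombMap D} {d : ℕ} {f₀ : M.Face}

theorem sum_vertex_mul (p : M.Vertex → ℝ) (w : D → ℝ) :
    ∑ h, p (M.vertex h) * w h = ∑ v, p v * ∑ h with M.vertex h = v, w h := by
  rw [← Finset.sum_fiberwise (g := M.vertex)]
  refine Finset.sum_congr rfl fun v _ => ?_
  rw [Finset.mul_sum]
  refine Finset.sum_congr rfl fun h hh => ?_
  rw [(Finset.mem_filter.1 hh).2]

namespace IsDWeight

variable {w w' : D → ℝ}

theorem add_eq (hw : M.IsDWeight d f₀ w) (hw' : M.IsDWeight d f₀ w') (h : D) :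
    w h + w (M.opp h) = w' h + w' (M.opp h) := by
  by_cases hh : M.IsOuterEdge f₀ h
  · rw [hw.outerEdge h hh, hw'.outerEdge h hh]
  · rw [hw.innerEdge h hh, hw'.innerEdge h hh]

theorem sum_vertex_eq (hw : M.IsDWeight d f₀ w) (hw' : M.IsDWeight d f₀ w') (v : M.Vertex) :
    ∑ h with M.vertex h = v, w h = ∑ h with M.vertex h = v, w' h := by
  by_cases hv : M.IsOuterVertex f₀ v
  · rw [hw.outerVertex v hv, hw'.outerVertex v hv]
  · rw [hw.innerVertex v hv, hw'.innerVertex v hv]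

theorem exists_potential (hM : M.IsPlanarMap) (hw : M.IsDWeight d f₀ w)
    (hw' : M.IsDWeight d f₀ w') :
    ∃ φ : M.Face → ℝ, φ f₀ = 0 ∧ ∀ h, w h - w' h = φ (M.leftFace h) - φ (M.rightFace h) := by
  obtain ⟨φ, hφ⟩ := hM.sphericalPair.exists_potential (fun h => w h - w' h)
    (fun h => by have := hw.add_eq hw' h; linarith) (fun p => by
      simp only [mul_sub, Finset.sum_sub_distrib, sum_vertex_mul, hw.sum_vertex_eq hw', sub_self])
  exact ⟨fun f => φ f - φ f₀, sub_self _, fun h => by rw [hφ]; simp only [rightFace]; ring⟩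

/-- If the difference of two `d/(d-2)`-orientations, the second of which is minimal, is written as
the coboundary of `φ`, then `φ` is nowhere greater than at the root-face: otherwise the boundary of
the region `{φ > 0}`, seen from the root-face, contains a counterclockwise circuit. -/
theorem potential_nonpos (hM : M.IsPlanarMap) (hw : M.IsDWeight d f₀ w)
    (hw' : M.IsDWeight d f₀ w') (hmin : (ofWeight M w').IsMinimal f₀) {φ : M.Face → ℝ}
    (h₀ : φ f₀ = 0) (hφ : ∀ h, w h - w' h = φ (M.leftFace h) - φ (M.rightFace h)) (f : M.Face) :
    φ f ≤ 0 := by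
  by_contra! hf
  -- the component of the root-face in `{φ ≤ 0}`
  set B : Set M.Face := {g | Relation.ReflTransGen
    (fun f₁ f₂ => ∃ h, M.leftFace h = f₁ ∧ M.rightFace h = f₂ ∧ φ f₂ ≤ 0) f₀ g} with hB
  have hB0 : f₀ ∈ B := Relation.ReflTransGen.refl
  have hBstep : ∀ h, M.leftFace h ∈ B → φ (M.rightFace h) ≤ 0 → M.rightFace h ∈ B :=
    fun h h1 h2 => Relation.ReflTransGen.tail h1 ⟨h, rfl, rfl, h2⟩
  have hBφ : ∀ g ∈ B, φ g ≤ 0 := by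
    intro g hg
    rcases Relation.ReflTransGen.cases_tail hg with rfl | ⟨_, -, _, -, -, h⟩
    · exact h₀.le
    · exact h
  obtain ⟨h, hl, hr⟩ := hM.exists_boundary (A := Bᶜ) (f := f) (g := f₀)
    (fun h => absurd hf (not_lt.2 (hBφ f h))) (fun h => h hB0)
  obtain ⟨n, c, hc, hcB⟩ := exists_isCycle_of_boundary hl hr
  have hcr : ∀ i, M.rightFace (c i) ∈ B := fun i => not_not.1 (hcB i).2
  have hcl : ∀ i, 0 < φ (M.leftFace (c i)) := by
    intro i
    by_contra! hi
    have := hBstep (M.opp (c i)) (hcr i) (by rwa [rightFace_opp])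
    rw [rightFace_opp] at this
    exact (hcB i).1 this
  have hcirc : (ofWeight M w').IsCircuit c := by
    refine ⟨hc, fun i => ofWeight_traversable.2 ?_⟩
    have h1 := hφ (c i)
    have h2 := hw.add_eq hw' (c i)
    have h3 := hcl i
    have h4 := hBφ _ (hcr i)
    have h5 := hw.nonneg (M.opp (c i))
    linarith
  refine hc.index_ne_of_isLeftOf hM (hmin n c hcirc) (i := 0) fun χ hχ => ?_
  have hconst : ∀ g ∈ B, χ g = χ f₀ := by
    intro g hg
    induction hg with
    | refl => rfl
    | @tail x y hx hy ih =>
      obtain ⟨h, rfl, rfl, hle⟩ := hy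
      rw [← ih, hχ h]
      intro j hj
      rcases M.edge_eq_iff.1 hj with rfl | rfl
      · exact (hcB j).1 hx
      · have := hBstep _ hx hle
        rw [rightFace_opp] at this
        exact (hcB j).1 this
  exact hconst _ (hcr 0)

theorem eq_of_isMinimal (hM : M.IsPlanarMap) (hw : M.IsDWeight d f₀ w)
    (hw' : M.IsDWeight d f₀ w') (hmin : (ofWeight M w).IsMinimal f₀)
    (hmin' : (ofWeight M w').IsMinimal f₀) : w = w' := by
  obtain ⟨φ, h0, hφ⟩ := hw.exists_potential hM hw'
  have h1 := hw.potential_nonpos hM hw' hmin' h0 hφ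
  have h2 := hw'.potential_nonpos hM hw hmin (φ := fun f => -φ f) (by simp [h0])
    (fun h => by have := hφ h; linarith)
  have h3 : ∀ f, φ f = 0 := fun f => le_antisymm (h1 f) (by have := h2 f; linarith)
  ext h
  have := hφ h
  rw [h3, h3] at this
  linarith

/-- Reversing a circuit: one unit of weight is moved along each of its edges. -/
theorem add_flow (hw : M.IsDWeight d f₀ w) {n : ℕ} {c : ZMod n → D}
    (hc : (ofWeight M w).IsCircuit c) :
    M.IsDWeight d f₀ fun h => w h + ((if ∃ i, c i = h then 1 else 0) -
      (if ∃ i, c i = M.opp h then 1 else 0)) := by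
  have hE : ∀ h, w h + ((if ∃ i, c i = h then (1 : ℝ) else 0) -
      (if ∃ i, c i = M.opp h then 1 else 0)) + (w (M.opp h) +
      ((if ∃ i, c i = M.opp h then 1 else 0) - (if ∃ i, c i = M.opp (M.opp h) then 1 else 0))) =
      w h + w (M.opp h) := fun h => by rw [M.opp_opp]; ring
  have hV : ∀ v, ∑ h with M.vertex h = v, (w h + ((if ∃ i, c i = h then (1 : ℝ) else 0) -
      (if ∃ i, c i = M.opp h then 1 else 0))) = ∑ h with M.vertex h = v, w h := fun v => by
    have := hc.1.sum_flow fun x => if x = v then 1 else 0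
    simp only [ite_mul, one_mul, zero_mul] at this
    rw [← Finset.sum_filter] at this
    rw [Finset.sum_add_distrib, this, add_zero]
  refine ⟨fun h => ?_, fun h hh => ?_, fun v hv => ?_, fun h hh => ?_, fun v hv => ?_⟩
  · obtain ⟨k, hk⟩ := hw.nat h
    by_cases h1 : ∃ i, c i = h
    · obtain ⟨i, rfl⟩ := h1
      rw [if_pos ⟨i, rfl⟩, if_neg fun ⟨j, hj⟩ => hc.1.opp_ne i j hj.symm]
      exact ⟨k + 1, by rw [hk]; push_cast; ring⟩
    · rw [if_neg h1]
      split_ifs with h2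
      · obtain ⟨i, hi⟩ := h2
        have h3 := ofWeight_traversable.1 (hc.2 i)
        rw [hi, M.opp_opp] at h3
        have h4 := hw.one_le_of_pos h3
        rw [hk] at h4
        exact ⟨k - 1, by rw [hk, Nat.cast_sub (by exact_mod_cast h4)]; push_cast; ring⟩
      · exact ⟨k, by rw [hk]; ring⟩
  · rw [hE, hw.innerEdge h hh]
  · rw [hV, hw.innerVertex v hv]
  · rw [hE, hw.outerEdge h hh]
  · rw [hV, hw.outerVertex v hv]

theorem finite_setOf (hd : 3 ≤ d) : {w | M.IsDWeight d f₀ w}.Finite := by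
  refine (Set.Finite.pi' fun _ : D => (Set.finite_Iic d).image (Nat.cast : ℕ → ℝ)).subset ?_
  intro w hw h
  obtain ⟨k, hk⟩ := hw.nat h
  refine ⟨k, ?_, hk.symm⟩
  have h1 := hw.nonneg (M.opp h)
  have h2 : (3 : ℝ) ≤ d := by exact_mod_cast hd
  have h3 : (k : ℝ) ≤ d := by
    by_cases hh : M.IsOuterEdge f₀ h
    · have := hw.outerEdge h hh
      linarith
    · have := hw.innerEdge h hh
      linarith
  exact_mod_cast h3

/-- Reversing a counterclockwise circuit increases by `1` the potential of the faces on its left and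
leaves that of the others unchanged, hence an orientation of maximal total potential is minimal. -/
theorem exists_isMinimal (hM : M.IsPlanarMap) (hd : 3 ≤ d) (hw : M.IsDWeight d f₀ w) :
    ∃ w', M.IsDWeight d f₀ w' ∧ (ofWeight M w').IsMinimal f₀ := by
  choose! φ hφ0 hφ using fun (w' : D → ℝ) (hw' : M.IsDWeight d f₀ w') =>
    hw'.exists_potential hM hw
  obtain ⟨u, hu, hmax⟩ := Set.exists_max_image {w | M.IsDWeight d f₀ w} (fun u => ∑ f, φ u f)
    (finite_setOf hd) ⟨w, hw⟩
  refine ⟨u, hu, fun n c hc => ?_⟩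
  by_contra hleft
  have hu' := IsDWeight.add_flow hu hc
  set u' := fun h => u h + ((if ∃ i, c i = h then (1 : ℝ) else 0) -
      (if ∃ i, c i = M.opp h then 1 else 0)) with hu'def
  have key : ∀ f, φ u' f = φ u f + if M.IsLeftOf c f then 1 else 0 := by
    intro f
    have h1 := hM.sphericalPair.const_right
      (fun f => φ u' f - (φ u f + if M.IsLeftOf c f then 1 else 0)) (fun h => by
        have h1 := hφ u hu h
        have h2 := hφ u' hu' h
        have h3 := hc.1.indicator_isLeftOf hM hleft h
        simp only [hu'def] at h2
        rw [h3] at h2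
        change φ u' (M.rightFace h) - (φ u (M.rightFace h) +
          if M.IsLeftOf c (M.rightFace h) then 1 else 0) = _
        linarith) f f₀
    simp only [hφ0 u hu, hφ0 u' hu', if_neg hleft, add_zero, sub_self] at h1
    linarith
  have h1 := hmax u' hu'
  have h2 : ∑ f, φ u f < ∑ f, φ u' f := by
    refine Finset.sum_lt_sum (fun f _ => ?_) ⟨M.leftFace (c 0), Finset.mem_univ _, ?_⟩
    · rw [key]
      split_ifs <;> simp
    · rw [key, if_pos ⟨0, .refl⟩]
      simp
  exact absurd h1 (not_le.2 h2)

end IsDWeight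

/-! ### The outer cycle and accessibility -/

namespace IsDWeight

variable {w : D → ℝ} {c : ZMod d → D}

/-- The total weight of the outer edges is `d`, that of the outer vertices too, so that no weight is
left at the outer vertices for the inner edges. -/
theorem eq_zero_of_isOuterVertex (hw : M.IsDWeight d f₀ w) (hc : M.IsContour f₀ c) {h : D}
    (hv : M.IsOuterVertex f₀ (M.vertex h)) (he : ¬ M.IsOuterEdge f₀ h) : w h = 0 := by
  set V := Finset.univ.filter fun v => M.IsOuterVertex f₀ v with hV
  have h1 : ∑ h with M.vertex h ∈ V, w h = d := by
    rw [sum_filter_vertex_mem, ← hc.card_isOuterVertex, Finset.cast_card]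
    exact Finset.sum_congr rfl fun v hv => hw.outerVertex v (by simpa [hV] using hv)
  have h2 : 2 * ∑ h with M.IsOuterEdge f₀ h, w h = 2 * d := by
    rw [two_mul_sum_filter fun h hh => ?_]
    · have := hc.card_isOuterEdge
      rw [show (2 * d : ℝ) = (2 * d : ℕ) by push_cast; rfl, ← this, Finset.cast_card]
      exact Finset.sum_congr rfl fun h hh => hw.outerEdge h (Finset.mem_filter.1 hh).2
    · rcases hh with hh | hh
      · exact Or.inr (by rwa [rightFace_opp])
      · exact Or.inl hh
  have h3 : ∑ h with M.IsOuterEdge f₀ h, w h = ∑ h with M.vertex h ∈ V, w h := by linarith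
  by_contra hne
  refine absurd h3 (ne_of_lt (Finset.sum_lt_sum_of_subset (i := h) (fun g hg => ?_) ?_ ?_ ?_
    fun g _ _ => hw.nonneg g))
  · simp only [hV, Finset.mem_filter, Finset.mem_univ, true_and] at hg ⊢
    exact hc.isOuterVertex_of_isOuterEdge hg
  · simpa [hV] using hv
  · simpa using he
  · exact lt_of_le_of_ne (hw.nonneg h) (Ne.symm hne)

/-- In a minimal orientation, the contour of the root-face is a directed cycle, with the root-face
on its left. -/
theorem weight_contour (hM : M.IsPlanarMap) (hw : M.IsDWeight d f₀ w) (hc : M.IsContour f₀ c)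
    (hmin : (ofWeight M w).IsMinimal f₀) (i : ZMod d) : w (M.opp (c i)) = 1 ∧ w (c i) = 0 := by
  have hedge : ∀ i, w (c i) + w (M.opp (c i)) = 1 := fun i =>
    hw.outerEdge _ (Or.inl (hc.leftFace_eq i))
  have hstep : ∀ i, w (M.opp (c (i + 1))) = w (M.opp (c i)) := by
    intro i
    have hv := hc.isOuterVertex_iff.2 ⟨i + 1, rfl⟩
    have h1 := hw.outerVertex _ hv
    rw [Finset.sum_filter, Fintype.sum_eq_add (c (i + 1)) (M.opp (c i))
      (hc.isCycle.opp_ne i (i + 1)).symm, if_pos rfl, if_pos (hc.isCycle.closed i).symm] at h1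
    · have := hedge (i + 1)
      linarith
    · rintro h ⟨h2, h3⟩
      split_ifs with hh
      · refine hw.eq_zero_of_isOuterVertex hc (hh ▸ hv) fun hout => ?_
        rcases hc.isCycle.eq_or_eq_of_vertex_eq hh (hc.isOuterEdge_iff.1 hout) with h4 | h4
        · exact h2 h4
        · exact h3 (by rw [h4, add_sub_cancel_right])
      · rfl
  have hconst : ∀ j, w (M.opp (c j)) = w (M.opp (c i)) := fun j =>
    hc.isCycle.const_of_add_one (f := fun j => w (M.opp (c j))) hstep j i
  have hpos : 0 < w (M.opp (c i)) := by
    by_contra hle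
    -- otherwise the reversed contour is a circuit with the root-face on its right
    have hcirc : (ofWeight M w).IsCircuit fun j => M.opp (c (-j)) := by
      refine ⟨hc.isCycle.reverse, fun j => ofWeight_traversable.2 ?_⟩
      rw [M.opp_opp]
      have h1 := hedge (-j)
      rw [hconst] at h1
      linarith
    refine hc.isCycle.reverse.index_ne_of_isLeftOf hM (hmin d _ hcirc) (i := 0) fun φ _ => ?_
    rw [rightFace_opp, hc.leftFace_eq]
  have h1 := hw.one_le_of_pos hpos
  have h2 := hedge i
  have h3 := hw.nonneg (c i)
  constructor <;> linarith

theorem indegree_eq_one (hM : M.IsPlanarMap) (hw : M.IsDWeight d f₀ w) (hc : M.IsContour f₀ c)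
    (hmin : (ofWeight M w).IsMinimal f₀) {v : M.Vertex} (hv : M.IsOuterVertex f₀ v) :
    (ofWeight M w).indegree v = 1 := by
  obtain ⟨j, rfl⟩ := hc.isOuterVertex_iff.1 hv
  have hj : M.vertex (M.opp (c (j - 1))) = M.vertex (c j) := by
    rw [← hc.isCycle.closed, sub_add_cancel]
  rw [indegree, Nat.card_eq_one_iff_unique]
  refine ⟨⟨fun g g' => ?_⟩, ⟨⟨M.opp (c (j - 1)), hj, ?_⟩⟩⟩
  · have key : ∀ g : {h : D // M.vertex h = M.vertex (c j) ∧ (ofWeight M w).ingoing h},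
        g.1 = M.opp (c (j - 1)) := by
      rintro ⟨g, hg, hg'⟩
      change 0 < w g at hg'
      have hout : M.IsOuterEdge f₀ g := by
        by_contra hout
        exact hg'.ne' (hw.eq_zero_of_isOuterVertex hc (hg ▸ hv) hout)
      rcases hc.isCycle.eq_or_eq_of_vertex_eq hg (hc.isOuterEdge_iff.1 hout) with rfl | h
      · exact absurd (hw.weight_contour hM hc hmin j).2 hg'.ne'
      · exact h
    exact Subtype.ext ((key g).trans (key g').symm)
  · change 0 < w _
    rw [(hw.weight_contour hM hc hmin _).1]
    exact one_pos

/-- The vertices that cannot be reached from an outer vertex receive weight only from the edges that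
they induce, which contradicts sparsity. -/
theorem accessibleFrom (hM : M.IsPlanarMap) (hd : 3 ≤ d) (hg : (d : ℕ∞) ≤ M.girth)
    (hw : M.IsDWeight d f₀ w) (hc : M.IsContour f₀ c) (hmin : (ofWeight M w).IsMinimal f₀) :
    (ofWeight M w).AccessibleFrom (M.vertex (c 0)) := by
  have := hc.isCycle.neZero
  by_contra hno
  set r := fun v₁ v₂ => ∃ h, (ofWeight M w).Traversable h ∧ M.vertex h = v₁ ∧
    M.vertex (M.opp h) = v₂ with hr
  set S := Finset.univ.filter fun v => ¬ Relation.ReflTransGen r (M.vertex (c 0)) v with hS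
  have memS : ∀ v, v ∈ S ↔ ¬ Relation.ReflTransGen r (M.vertex (c 0)) v := by simp [hS]
  have hne : S.Nonempty := by
    simp only [AccessibleFrom, not_forall] at hno
    obtain ⟨v, hv⟩ := hno
    exact ⟨v, (memS v).2 hv⟩
  have houter : ∀ v ∈ S, ¬ M.IsOuterVertex f₀ v := by
    intro v hv hout
    obtain ⟨j, rfl⟩ := hc.isOuterVertex_iff.1 hout
    refine (memS _).1 hv ?_
    have h1 : ∀ k : ℕ, Relation.ReflTransGen r (M.vertex (c 0)) (M.vertex (c (k : ZMod d))) := by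
      intro k
      induction k with
      | zero => rw [Nat.cast_zero]
      | succ k ih =>
        rw [Nat.cast_succ, hc.isCycle.closed]
        refine ih.tail ⟨c k, ofWeight_traversable.2 ?_, rfl, rfl⟩
        rw [(hw.weight_contour hM hc hmin _).1]
        exact one_pos
    rw [← ZMod.natCast_zmod_val j]
    exact h1 _
  obtain ⟨H, hH⟩ : ∃ H : D → Prop, ∀ h, H h ↔ M.vertex h ∈ S ∧ M.vertex (M.opp h) ∈ S :=
    ⟨_, fun _ => Iff.rfl⟩
  have h1 : ∑ h with M.vertex h ∈ S, w h = d * S.card := by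
    rw [sum_filter_vertex_mem, mul_comm, ← nsmul_eq_mul, ← Finset.sum_const]
    exact Finset.sum_congr rfl fun v hv => hw.innerVertex v (houter v hv)
  have h2 : ∑ h with H h, w h = ∑ h with M.vertex h ∈ S, w h := by
    refine Finset.sum_subset (fun h hh => ?_) fun h hh hh' => ?_
    · simp only [Finset.mem_filter, Finset.mem_univ, true_and, hH] at hh ⊢
      exact hh.1
    · simp only [Finset.mem_filter, Finset.mem_univ, true_and, hH] at hh hh'
      by_contra hne
      refine hh' ⟨hh, (memS _).2 fun hreach => (memS _).1 hh (hreach.tail ⟨M.opp h, ?_, rfl, ?_⟩)⟩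
      · rw [ofWeight_traversable, M.opp_opp]
        exact lt_of_le_of_ne (hw.nonneg h) (Ne.symm hne)
      · rw [M.opp_opp]
  have h3 : 2 * ∑ h with H h, w h = (Finset.univ.filter H).card * ((d : ℝ) - 2) := by
    rw [two_mul_sum_filter fun h hh => ?_, ← nsmul_eq_mul, ← Finset.sum_const]
    · refine Finset.sum_congr rfl fun h hh => hw.innerEdge h fun hout => ?_
      exact houter _ ((hH h).1 (Finset.mem_filter.1 hh).2).1 (hc.isOuterVertex_of_isOuterEdge hout)
    · rw [hH, M.opp_opp]
      exact ((hH h).1 hh).symm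
  have hd' : (3 : ℝ) ≤ d := by exact_mod_cast hd
  rcases hM.sparsity hg hne hH with ⟨-, h4⟩ | h4
  · have h5 : ((Finset.univ.filter H).card : ℝ) + 2 ≤ 2 * S.card := by exact_mod_cast h4
    have h6 := mul_le_mul_of_nonneg_left h5 (Nat.cast_nonneg (α := ℝ) d)
    have h7 : (0 : ℝ) ≤ (Finset.univ.filter H).card := Nat.cast_nonneg _
    linarith
  · have h5 : (d : ℝ) * (Finset.univ.filter H).card + 4 * d ≤
        2 * d * S.card + 2 * (Finset.univ.filter H).card := by exact_mod_cast h4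
    linarith

theorem memBTilde (hM : M.IsPlanarMap) (hd : 3 ≤ d) (hg : (d : ℕ∞) ≤ M.girth)
    (hw : M.IsDWeight d f₀ w) (hc : M.IsContour f₀ c) (hmin : (ofWeight M w).IsMinimal f₀) :
    (ofWeight M w).MemBTilde f₀ := by
  have hcont := hw.weight_contour hM hc hmin
  have hone : ∀ j, (ofWeight M w).OneWayAlong (c j) := fun j =>
    ⟨by change ¬ 0 < w _; rw [(hcont j).2]; exact lt_irrefl _,
      by change 0 < w _; rw [(hcont j).1]; exact one_pos⟩
  refine ⟨⟨hmin, fun h hh => Or.inr ?_⟩, ⟨_, hc.isOuterVertex_iff.2 ⟨0, rfl⟩,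
    hw.accessibleFrom hM hd hg hc hmin⟩, ⟨d, c, hc.isCycle, fun i =>
      ⟨hc.leftFace_eq i, hc.add_one i⟩⟩, fun v hv => hw.indegree_eq_one hM hc hmin hv,
    fun h hh => ?_⟩
  · obtain ⟨j, hj⟩ := hc.isOuterEdge_iff.1 hh
    rcases M.edge_eq_iff.1 hj with rfl | rfl
    · exact Or.inl ⟨hone j, hc.rightFace_ne j⟩
    · rw [M.opp_opp]
      exact Or.inr ⟨hone j, hc.rightFace_ne j⟩
  · obtain ⟨j, hj⟩ := hc.isOuterEdge_iff.1 hh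
    rcases M.edge_eq_iff.1 hj with rfl | rfl
    · exact Or.inl ⟨hone j, (hcont j).2, (hcont j).1⟩
    · rw [M.opp_opp]
      exact Or.inr ⟨hone j, (hcont j).2, (hcont j).1⟩

end IsDWeight

end CombMap

theorem theorem4p1 {D : Type*} [Fintype D] (d : ℕ) (hd : 3 ≤ d)
    (M : CombMap D) (hM : M.IsAngulation d) (f₀ : M.Face) :
    ((∃ O : WeightedBiorientation M, O.IsDOrientation d f₀) ↔ M.girth = d) ∧
    (M.girth = d →
      (∃! O : WeightedBiorientation M, O.IsDOrientation d f₀ ∧ O.IsMinimal f₀) ∧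
      ∀ O : WeightedBiorientation M, O.IsDOrientation d f₀ → O.IsMinimal f₀ →
        O.MemBTilde f₀) := by
  refine ⟨⟨fun ⟨O, hO⟩ => hO.isDWeight.girth_eq hM, fun hg => ?_⟩, fun hg => ⟨?_, ?_⟩⟩
  · obtain ⟨w, hw⟩ := hM.exists_isDWeight (f₀ := f₀) hd hg
    exact ⟨_, isDOrientation_ofWeight hw⟩
  · obtain ⟨w, hw⟩ := hM.exists_isDWeight (f₀ := f₀) hd hg
    obtain ⟨u, hu, hmin⟩ := hw.exists_isMinimal hM.planar hd
    refine ⟨ofWeight M u, ⟨isDOrientation_ofWeight hu, hmin⟩, fun O ⟨hO, hOmin⟩ => ?_⟩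
    have hOw := hO.nat.eq_ofWeight
    rw [hOw] at hOmin
    rw [hOw, hO.isDWeight.eq_of_isMinimal hM.planar hu hOmin hmin]
  · intro O hO hmin
    obtain ⟨c, hc⟩ := hM.exists_isContour hg f₀
    have hOw := hO.nat.eq_ofWeight
    rw [hOw] at hmin ⊢
    exact hO.isDWeight.memBTilde hM.planar hd hg.ge hc hmin
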